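/- Let $n\ge 2$, let $\Omega_n=\{1<2<\cdots<n\}$, and let $\mathcal{PIO}_n$ be the monoid (transformations act on the right, so $\alpha\beta$ means first $\alpha$, then $\beta$) of all partial transformations $\alpha$ of $\Omega_n$ that are order-preserving ($x\le y$ implies $x\alpha\le y\alpha$ on the domain) and whose domain and image are intervals of $\Omega_n$ (possibly empty). For $1\le i\le n-1$ let $a_i,b_i,e_i,f_{i+1}\in\mathcal{PIO}_n$ be given by: $xa_i=x$ for $x\le i$ and $xa_i=x-1$ for $x>i$; $xb_i=x+1$ for $x\le i$ and $xb_i=x$ for $x>i$; $e_i$ is the partial identity with domain $\{1,\dots,i\}$; $f_{i+1}$ is the partial identity with domain $\{i+1,\dots,n\}$. Put $A=\{a_1,\dots,a_{n-1}\}$, $B=\{b_1,\dots,b_{n-1}\}$, $E=\{e_1,\dots,e_{n-1}\}$, $F=\{f_2,\dots,f_n\}$. Let $\bar R$ consist of the following monoid relations over the alphabet $A\cup B\cup E\cup F$, where a chain $u=v=w$ stands for the two relations $u=v$ and $v=w$: - $(R_1)$ $a_ia_{n-1}=a_i$ $(1\le i\le n-1)$; $a_ia_j=a_{j+1}a_i$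 $(1\le i\le j\le n-2)$; - $(R_{1b})$ $b_ib_1=b_i$ $(1\le i\le n-1)$; $b_ib_{j+1}=b_{j+1}b_{i+1}$ $(1\le i\le j\le n-2)$; - $(R_2)$ $e_i^2=e_i$ and $f_{i+1}^2=f_{i+1}$ $(1\le i\le n-1)$; - $(R_3)$ $e_if_j=f_je_i$ $(2\le j\le i\le n-1)$; $e_if_{i+1}=f_{i+1}e_i=e_1f_n$ $(1\le i\le n-1)$; $e_ie_{i+1}=e_{i+1}e_i=e_i$ $(1\le i\le n-2)$; $f_if_{i+1}=f_{i+1}f_i=f_{i+1}$ $(2\le i\le n-1)$; - $(R_4)$ $a_ie_{i-1}=e_{i-1}$ $(2\le i\le n-1)$; $a_ie_j=e_{j+1}a_i$ $(1\le i\le j\le n-2)$; $a_{n-1}e_{n-1}=a_{n-1}$; $e_ia_i=e_i$ $(1\le i\le n-1)$; - $(R_{4b})$ $b_if_{i+2}=f_{i+2}$ $(1\le i\le n-2)$; $b_if_{j+1}=f_jb_i$ $(2\le j\le i\le n-1)$; $b_1f_2=b_1$; $f_{i+1}b_i=f_{i+1}$ $(1\le i\le n-1)$; - $(R_5)$ $a_if_j=f_ja_i$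 $(2\le j\le i\le n-1)$; $a_if_j=f_{j+1}a_i$ $(1\le i<j\le n-1)$; $a_1f_n=e_1f_n$; $a_{n-1}f_n=e_1f_n$; - $(R_{5b})$ $b_ie_j=e_jb_i$ $(1\le i<j\le n-1)$; $b_ie_j=e_{j-1}b_i$ $(2\le j\le i\le n-1)$; $b_1e_1=f_ne_1$; $b_{n-1}e_1=f_ne_1$; - $(R_6)$ $f_{i+1}a_i=f_{i+1}a_1$ $(2\le i\le n-1)$; - $(R_{6b})$ $e_ib_i=e_ib_{n-1}$ $(1\le i\le n-2)$; - $(R_7)$ $b_ia_j=a_jb_i$ $(1\le i<j\le n-1)$; $b_ia_1=a_i$ and $a_ib_{n-1}=b_i$ $(1\le i\le n-1)$. Then the $4n-4$ letters denote pairwise distinct elements, which generate $\mathcal{PIO}_n$, and $\mathcal{PIO}_n$ is defined by the presentation $\langle A\cup B\cup E\cup F\mid\bar R\rangle$: if $\sim_{\bar R}$ is the congruence generated by $\bar R$ on the free monoid, there is an isomorphism $(A\cup B\cup E\cup F)^*/{\sim_{\bar R}}\to\mathcal{PIO}_n$ that sends the class of each letter to the transformation it denotes. The presentation has $4n-4$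 generators, and the list above has $5n^2+3n-10$ relations (counted as listed), which are pairwise distinct for $n\ge 3$. Moreover, with $e_n$ and $f_1$ denoting the empty word, let $\overline W$ be the set of words consisting of $e_1f_n$ and all $e_if_ja_{i_k}\cdots a_{i_1}a_1^{j-1}b_{n-1}^{\ell}$ with $1\le j\le i\le n$, $j\le i_1<\cdots<i_k\le i-1$, $0\le k\le i-j$ and $0\le\ell\le n-i+j+k-1$. Then every word is $\sim_{\bar R}$-equivalent to a word in $\overline W$, and $|\overline W|=|\mathcal{PIO}_n|$. -/

import Mathlib

namespace ChainPres

/-- The chain `1 < 2 < ⋯ < n`. -/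
abbrev Chain (n : ℕ) : Type := {x : ℕ // 1 ≤ x ∧ x ≤ n}

/-- Partial transformations of the chain; `α.map x = none` means that `x` is not in the domain. -/
@[ext]
structure PT (n : ℕ) : Type where
  map : Chain n → Option (Chain n)

/-- Transformations act on the right: `α * β` is "first `α`, then `β`". -/
instance (n : ℕ) : Monoid (PT n) where
  mul α β := ⟨fun x => (α.map x).bind β.map⟩
  one := ⟨fun x => some x⟩
  mul_assoc α β γ := PT.ext (funext fun x => Option.bind_assoc (α.map x) β.map γ.map)
  one_mul _ := rfl
  mul_one α := PT.ext (funext fun x => Option.bind_fun_some (α.map x))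

theorem PT.mul_map {n : ℕ} (α β : PT n) (x : Chain n) :
    (α * β).map x = (α.map x).bind β.map := rfl

theorem PT.one_map {n : ℕ} (x : Chain n) : (1 : PT n).map x = some x := rfl

/-- The domain of a partial transformation. -/
def PT.Dom {n : ℕ} (α : PT n) : Set (Chain n) := {x | ∃ y, α.map x = some y}

/-- The image of a partial transformation. -/
def PT.Im {n : ℕ} (α : PT n) : Set (Chain n) := {y | ∃ x, α.map x = some y}

/-- `x ≤ y` implies `xα ≤ yα` for all `x, y` in the domain. -/
def PT.OrderPreserving {n : ℕ} (α : PT n) : Prop :=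
  ∀ x y x' y' : Chain n, α.map x = some x' → α.map y = some y' → x ≤ y → x' ≤ y'

/-- The monoid of all order-preserving partial transformations of the chain `1 < ⋯ < n` whose
domain and image are intervals (possibly empty). -/
def IntervalMonoid (n : ℕ) : Submonoid (PT n) where
  carrier := {α | α.OrderPreserving ∧ α.Dom.OrdConnected ∧ α.Im.OrdConnected}
  one_mem' := by
    refine ⟨?_, ⟨fun x _ y _ z _ => ⟨z, rfl⟩⟩, ⟨fun x _ y _ z _ => ⟨z, rfl⟩⟩⟩
    intro x y x' y' hx hy h
    rw [PT.one_map, Option.some.injEq] at hx hy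
    exact hx ▸ hy ▸ h
  mul_mem' := by
    rintro α β ⟨hα, hαd, hαi⟩ ⟨hβ, hβd, hβi⟩
    refine ⟨?_, ⟨?_⟩, ⟨?_⟩⟩
    · intro x y x' y' hx hy h
      rw [PT.mul_map, Option.bind_eq_some_iff] at hx hy
      obtain ⟨p, hp, hpx⟩ := hx
      obtain ⟨q, hq, hqy⟩ := hy
      exact hβ p q x' y' hpx hqy (hα x y p q hp hq h)
    · rintro x ⟨x', hx⟩ y ⟨y', hy⟩ z ⟨hxz, hzy⟩
      rw [PT.mul_map, Option.bind_eq_some_iff] at hx hy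
      obtain ⟨p, hp, hpx⟩ := hx
      obtain ⟨q, hq, hqy⟩ := hy
      obtain ⟨r, hr⟩ := hαd.out ⟨p, hp⟩ ⟨q, hq⟩ ⟨hxz, hzy⟩
      obtain ⟨s, hs⟩ := hβd.out ⟨x', hpx⟩ ⟨y', hqy⟩
        ⟨hα x z p r hp hr hxz, hα z y r q hr hq hzy⟩
      exact ⟨s, by rw [PT.mul_map, hr]; exact hs⟩
    · rintro u ⟨x, hx⟩ w ⟨y, hy⟩ v ⟨huv, hvw⟩
      have hx0 := hx
      have hy0 := hy
      rw [PT.mul_map, Option.bind_eq_some_iff] at hx hy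
      obtain ⟨p, hp, hpx⟩ := hx
      obtain ⟨q, hq, hqy⟩ := hy
      obtain ⟨t, ht⟩ := hβi.out ⟨p, hpx⟩ ⟨q, hqy⟩ ⟨huv, hvw⟩
      rcases le_total t p with htp | hpt
      · have : v = u := le_antisymm (hβ t p v u ht hpx htp) huv
        exact ⟨x, this ▸ hx0⟩
      rcases le_total q t with hqt | htq
      · have : v = w := le_antisymm hvw (hβ q t w v hqy ht hqt)
        exact ⟨y, this ▸ hy0⟩
      obtain ⟨z, hz⟩ := hαi.out ⟨x, hp⟩ ⟨y, hq⟩ ⟨hpt, htq⟩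
      exact ⟨z, by rw [PT.mul_map, hz]; exact ht⟩

/-- The alphabet: letters `a i`, `b i`, `e i` for `1 ≤ i ≤ n - 1` and `f j` for `2 ≤ j ≤ n`. -/
inductive Letter (n : ℕ) : Type
  | a (i : {i : ℕ // 1 ≤ i ∧ i ≤ n - 1}) : Letter n
  | b (i : {i : ℕ // 1 ≤ i ∧ i ≤ n - 1}) : Letter n
  | e (i : {i : ℕ // 1 ≤ i ∧ i ≤ n - 1}) : Letter n
  | f (j : {j : ℕ // 2 ≤ j ∧ j ≤ n}) : Letter n

/-- The partial transformations named by the letters: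
`a i` fixes `1, …, i` and sends `x > i` to `x - 1`;
`b i` sends `x ≤ i` to `x + 1` and fixes `i + 1, …, n`;
`e i` is the partial identity on `{1, …, i}`; `f j` is the partial identity on `{j, …, n}`. -/
def genPT (n : ℕ) : Letter n → PT n
  | .a i => ⟨fun x => if h : x.1 ≤ i.1 then some x else some ⟨x.1 - 1, by omega⟩⟩
  | .b i => ⟨fun x => if h : x.1 ≤ i.1 then some ⟨x.1 + 1, by omega⟩ else some x⟩
  | .e i => ⟨fun x => if x.1 ≤ i.1 then some x else none⟩
  | .f j => ⟨fun x => if j.1 ≤ x.1 then some x else none⟩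

theorem genPT_mem (n : ℕ) (x : Letter n) : genPT n x ∈ IntervalMonoid n := by
  suffices h : ∃ P : ℕ → ℕ → Prop,
      (∀ z y : Chain n, (genPT n x).map z = some y ↔ P z.1 y.1) ∧
      (∀ z y z' y', 1 ≤ z → y ≤ n → P z z' → P y y' → z ≤ y → z' ≤ y') ∧
      (∀ z y z' y' t, 1 ≤ z → y ≤ n → P z z' → P y y' → z ≤ t → t ≤ y →
        ∃ t', (1 ≤ t' ∧ t' ≤ n) ∧ P t t') ∧
      (∀ z y z' y' t', (1 ≤ z ∧ z ≤ n) → (1 ≤ y ∧ y ≤ n) → (1 ≤ z' ∧ y' ≤ n) →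
        P z z' → P y y' → z' ≤ t' → t' ≤ y' → ∃ t, (1 ≤ t ∧ t ≤ n) ∧ P t t') by
    obtain ⟨P, hP, h1, h2, h3⟩ := h
    refine ⟨?_, ⟨?_⟩, ⟨?_⟩⟩
    · intro z y z' y' hz hy hzy
      rw [hP] at hz hy
      exact h1 _ _ _ _ z.2.1 y.2.2 hz hy hzy
    · rintro z ⟨z', hz⟩ y ⟨y', hy⟩ t ⟨hzt, hty⟩
      rw [hP] at hz hy
      obtain ⟨t', ht', h⟩ := h2 _ _ _ _ t.1 z.2.1 y.2.2 hz hy hzt hty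
      exact ⟨⟨t', ht'⟩, (hP _ _).2 h⟩
    · rintro z' ⟨z, hz⟩ y' ⟨y, hy⟩ t' ⟨hzt, hty⟩
      rw [hP] at hz hy
      obtain ⟨t, ht, h⟩ := h3 _ _ _ _ t'.1 z.2 y.2 ⟨z'.2.1, y'.2.2⟩ hz hy hzt hty
      exact ⟨⟨t, ht⟩, (hP _ _).2 h⟩
  rcases x with i | i | i | j
  · refine ⟨fun x y => (x ≤ i.1 ∧ y = x) ∨ (i.1 < x ∧ y + 1 = x), ?_, ?_, ?_, ?_⟩
    · intro z y
      simp only [genPT]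
      split_ifs <;> simp only [Option.some.injEq, Subtype.ext_iff] <;> omega
    · intros; omega
    · intro z y z' y' t _ _ _ _ _ _
      by_cases h : t ≤ i.1
      · exact ⟨t, by omega, by omega⟩
      · exact ⟨t - 1, by omega, by omega⟩
    · intro z y z' y' t' _ _ _ _ _ _ _
      by_cases h : t' ≤ i.1
      · exact ⟨t', by omega, by omega⟩
      · exact ⟨t' + 1, by omega, by omega⟩
  · refine ⟨fun x y => (x ≤ i.1 ∧ y = x + 1) ∨ (i.1 < x ∧ y = x), ?_, ?_, ?_, ?_⟩
    · intro z y
      simp only [genPT]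
      split_ifs <;> simp only [Option.some.injEq, Subtype.ext_iff] <;> omega
    · intros; omega
    · intro z y z' y' t _ _ _ _ _ _
      by_cases h : t ≤ i.1
      · exact ⟨t + 1, by omega, by omega⟩
      · exact ⟨t, by omega, by omega⟩
    · intro z y z' y' t' _ _ _ _ _ _ _
      by_cases h : t' ≤ i.1
      · exact ⟨t' - 1, by omega, by omega⟩
      · exact ⟨t', by omega, by omega⟩
  · refine ⟨fun x y => x ≤ i.1 ∧ y = x, ?_, ?_, ?_, ?_⟩
    · intro z y
      simp only [genPT]
      split_ifs with h
      · simp only [Option.some.injEq, Subtype.ext_iff]; omega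
      · exact ⟨fun h' => h'.elim, fun h' => absurd h'.1 h⟩
    · intros; omega
    · intro z y z' y' t _ _ _ _ _ _
      exact ⟨t, by omega, by omega⟩
    · intro z y z' y' t' _ _ _ _ _ _ _
      exact ⟨t', by omega, by omega⟩
  · refine ⟨fun x y => j.1 ≤ x ∧ y = x, ?_, ?_, ?_, ?_⟩
    · intro z y
      simp only [genPT]
      split_ifs with h
      · simp only [Option.some.injEq, Subtype.ext_iff]; omega
      · exact ⟨fun h' => h'.elim, fun h' => absurd h'.1 h⟩
    · intros; omega
    · intro z y z' y' t _ _ _ _ _ _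
      exact ⟨t, by omega, by omega⟩
    · intro z y z' y' t' _ _ _ _ _ _ _
      exact ⟨t', by omega, by omega⟩

/-- The elements of the monoid named by the letters. -/
def gen (n : ℕ) (x : Letter n) : IntervalMonoid n := ⟨genPT n x, genPT_mem n x⟩

/-- Words over the alphabet. -/
abbrev Word (n : ℕ) : Type := FreeMonoid (Letter n)

/-- The one-letter word `a i`; by convention the empty word if there is no such letter. -/
def wa (n i : ℕ) : Word n :=
  if h : 1 ≤ i ∧ i ≤ n - 1 then FreeMonoid.of (.a ⟨i, h⟩) else 1

/-- The one-letter word `b i`; by convention the empty word if there is no such letter. -/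
def wb (n i : ℕ) : Word n :=
  if h : 1 ≤ i ∧ i ≤ n - 1 then FreeMonoid.of (.b ⟨i, h⟩) else 1

/-- The one-letter word `e i`; by convention the empty word if there is no such letter,
in particular for `i = n`. -/
def we (n i : ℕ) : Word n :=
  if h : 1 ≤ i ∧ i ≤ n - 1 then FreeMonoid.of (.e ⟨i, h⟩) else 1

/-- The one-letter word `f j`; by convention the empty word if there is no such letter,
in particular for `j = 1`. -/
def wf (n j : ℕ) : Word n :=
  if h : 2 ≤ j ∧ j ≤ n then FreeMonoid.of (.f ⟨j, h⟩) else 1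

/-- The relations `r i` for `lo ≤ i ≤ hi`. -/
def family {n : ℕ} (lo hi : ℕ) (r : ℕ → Word n × Word n) : Multiset (Word n × Word n) :=
  (Finset.Icc lo hi).val.map r

/-- The relations `r i j` for `lo ≤ i ≤ j ≤ hi`. -/
def familyLE {n : ℕ} (lo hi : ℕ) (r : ℕ → ℕ → Word n × Word n) : Multiset (Word n × Word n) :=
  ((Finset.Icc lo hi ×ˢ Finset.Icc lo hi).filter (fun p => p.1 ≤ p.2)).val.map
    (fun p => r p.1 p.2)

/-- The relations `r i j` for `lo ≤ i < j ≤ hi`. -/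
def familyLT {n : ℕ} (lo hi : ℕ) (r : ℕ → ℕ → Word n × Word n) : Multiset (Word n × Word n) :=
  ((Finset.Icc lo hi ×ˢ Finset.Icc lo hi).filter (fun p => p.1 < p.2)).val.map
    (fun p => r p.1 p.2)

/-! The lists of relations. A pair `(u, v)` is the relation `u = v`, and a chain `u = v = w` is the
two relations `u = v` and `v = w`. Indices that occur below are always in range. -/

def R1 (n : ℕ) : Multiset (Word n × Word n) :=
  family 1 (n - 1) (fun i => (wa n i * wa n (n - 1), wa n i))
  + familyLE 1 (n - 2) (fun i j => (wa n i * wa n j, wa n (j + 1) * wa n i))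

def R1b (n : ℕ) : Multiset (Word n × Word n) :=
  family 1 (n - 1) (fun i => (wb n i * wb n 1, wb n i))
  + familyLE 1 (n - 2) (fun i j => (wb n i * wb n (j + 1), wb n (j + 1) * wb n (i + 1)))

def R2 (n : ℕ) : Multiset (Word n × Word n) :=
  family 1 (n - 1) (fun i => (we n i ^ 2, we n i))
  + family 1 (n - 1) (fun i => (wf n (i + 1) ^ 2, wf n (i + 1)))

def R3 (n : ℕ) : Multiset (Word n × Word n) :=
  familyLE 2 (n - 1) (fun j i => (we n i * wf n j, wf n j * we n i))
  + family 1 (n - 1) (fun i => (we n i * wf n (i + 1), wf n (i + 1) * we n i))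
  + family 1 (n - 1) (fun i => (wf n (i + 1) * we n i, we n 1 * wf n n))
  + family 1 (n - 2) (fun i => (we n i * we n (i + 1), we n (i + 1) * we n i))
  + family 1 (n - 2) (fun i => (we n (i + 1) * we n i, we n i))
  + family 2 (n - 1) (fun i => (wf n i * wf n (i + 1), wf n (i + 1) * wf n i))
  + family 2 (n - 1) (fun i => (wf n (i + 1) * wf n i, wf n (i + 1)))

def R4 (n : ℕ) : Multiset (Word n × Word n) :=
  family 2 (n - 1) (fun i => (wa n i * we n (i - 1), we n (i - 1)))
  + familyLE 1 (n - 2) (fun i j => (wa n i * we n j, we n (j + 1) * wa n i))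
  + {(wa n (n - 1) * we n (n - 1), wa n (n - 1))}
  + family 1 (n - 1) (fun i => (we n i * wa n i, we n i))

def R4b (n : ℕ) : Multiset (Word n × Word n) :=
  family 1 (n - 2) (fun i => (wb n i * wf n (i + 2), wf n (i + 2)))
  + familyLE 2 (n - 1) (fun j i => (wb n i * wf n (j + 1), wf n j * wb n i))
  + {(wb n 1 * wf n 2, wb n 1)}
  + family 1 (n - 1) (fun i => (wf n (i + 1) * wb n i, wf n (i + 1)))

def R5 (n : ℕ) : Multiset (Word n × Word n) :=
  familyLE 2 (n - 1) (fun j i => (wa n i * wf n j, wf n j * wa n i))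
  + familyLT 1 (n - 1) (fun i j => (wa n i * wf n j, wf n (j + 1) * wa n i))
  + {(wa n 1 * wf n n, we n 1 * wf n n)}
  + {(wa n (n - 1) * wf n n, we n 1 * wf n n)}

def R5b (n : ℕ) : Multiset (Word n × Word n) :=
  familyLT 1 (n - 1) (fun i j => (wb n i * we n j, we n j * wb n i))
  + familyLE 2 (n - 1) (fun j i => (wb n i * we n j, we n (j - 1) * wb n i))
  + {(wb n 1 * we n 1, wf n n * we n 1)}
  + {(wb n (n - 1) * we n 1, wf n n * we n 1)}

def R6 (n : ℕ) : Multiset (Word n × Word n) :=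
  family 2 (n - 1) (fun i => (wf n (i + 1) * wa n i, wf n (i + 1) * wa n 1))

def R6b (n : ℕ) : Multiset (Word n × Word n) :=
  family 1 (n - 2) (fun i => (we n i * wb n i, we n i * wb n (n - 1)))

def R7 (n : ℕ) : Multiset (Word n × Word n) :=
  familyLT 1 (n - 1) (fun i j => (wb n i * wa n j, wa n j * wb n i))
  + family 1 (n - 1) (fun i => (wb n i * wa n 1, wa n i))
  + family 1 (n - 1) (fun i => (wa n i * wb n (n - 1), wb n i))

/-- All defining relations, in the multiplicity in which they are listed. -/
def Rbar (n : ℕ) : Multiset (Word n × Word n) :=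
  R1 n + R1b n + R2 n + R3 n + R4 n + R4b n + R5 n + R5b n + R6 n + R6b n + R7 n

/-- `u = v` is one of the defining relations. -/
def IsRel (n : ℕ) (u v : Word n) : Prop := (u, v) ∈ Rbar n

/-- The word `a iₖ ⋯ a i₁`, where `s = {i₁ < ⋯ < iₖ}`. -/
def descWord (n : ℕ) (s : Finset ℕ) : Word n :=
  ((s.sort (· ≥ ·)).map (wa n)).prod

/-- The words `e i f j a iₖ ⋯ a i₁ (a 1)^(j-1) (b (n-1))^ℓ` with `1 ≤ j ≤ i ≤ n`,
`j ≤ i₁ < ⋯ < iₖ ≤ i - 1` and `0 ≤ ℓ ≤ n - i + j + k - 1`, together with `e 1 f n`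
(with `e n` and `f 1` the empty word). -/
def Wbar (n : ℕ) : Set (Word n) :=
  {w | ∃ (i j l : ℕ) (s : Finset ℕ), 1 ≤ j ∧ j ≤ i ∧ i ≤ n ∧ s ⊆ Finset.Icc j (i - 1) ∧
      l ≤ n - i + j + s.card - 1 ∧
      w = we n i * wf n j * descWord n s * wa n 1 ^ (j - 1) * wb n (n - 1) ^ l}
  ∪ {we n 1 * wf n n}

end ChainPres

open ChainPres

namespace ChainPres

/-! A canonical word can be recovered from its value. A nonempty element of the monoid has domain
`{j, …, i}`, and because its image is an interval, consecutive values either stay or grow by one.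
The stationary places form the set `s`, the first value is `l + 1`, and the bound on `l` says that
the last value is at most `n`. Hence evaluation is a bijection from `Wbar n` onto the monoid
(`eval_injOn_Wbar`, `eval_surjOn_Wbar`).

It remains to reach a canonical word by the relations alone. This is done in any monoid satisfying
`Relations`, and then applied to the presented monoid. All `e` and `f` travel to the left and merge
into one `e i * f j` (`mul_e_f_mem`). The rest is a product of letters `a u` and the upward shift `b
(n - 1)`, because `b u = a u * b (n - 1)`. Such a product acts as a full transformation and reduces
to a decreasing product of `a`s followed by a power of the shift (`isFullNormal_of_mem_closure`).
Restriction by `e i * f j` then absorbs the indices from `i` on and turns the indices below `j` into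
powers of `a 1`, which are padded to the exponent `j - 1` (`isNormal_of_isFullNormal`). If `i < j`,
everything collapses to the empty map `e 1 * f n`.

The transformations satisfy the relations (`relations_eval`), so the presented monoid maps to the
interval monoid. Two classes with the same value share their canonical word, which gives injectivity
(`exists_presentedMonoid_equiv`). The number of relations is separate arithmetic, and their
distinctness comes from the invariant `key`. -/

/-! ### The defining relations as identities in a monoid -/

theorem forall_mem_family {n : ℕ} (lo hi : ℕ) (r : ℕ → Word n × Word n)
    (c : Word n × Word n → Prop) :
    (∀ p ∈ family lo hi r, c p) ↔ ∀ i, lo ≤ i → i ≤ hi → c (r i) := by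
  simp only [family, Multiset.mem_map, Finset.mem_val, Finset.mem_Icc, forall_exists_index, and_imp]
  exact ⟨fun h i h1 h2 => h _ i h1 h2 rfl, fun h p i h1 h2 hp => hp ▸ h i h1 h2⟩

theorem forall_mem_familyLE {n : ℕ} (lo hi : ℕ) (r : ℕ → ℕ → Word n × Word n)
    (c : Word n × Word n → Prop) :
    (∀ p ∈ familyLE lo hi r, c p) ↔ ∀ i j, lo ≤ i → i ≤ j → j ≤ hi → c (r i j) := by
  simp only [familyLE, Multiset.mem_map, Finset.mem_val, Finset.mem_filter, Finset.mem_product,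
    Finset.mem_Icc]
  constructor
  · intro h i j h1 h2 h3
    exact h _ ⟨(i, j), by simp only; omega, rfl⟩
  · rintro h _ ⟨⟨i, j⟩, hij, rfl⟩
    exact h i j (by omega) (by omega) (by omega)

theorem forall_mem_familyLT {n : ℕ} (lo hi : ℕ) (r : ℕ → ℕ → Word n × Word n)
    (c : Word n × Word n → Prop) :
    (∀ p ∈ familyLT lo hi r, c p) ↔ ∀ i j, lo ≤ i → i < j → j ≤ hi → c (r i j) := by
  simp only [familyLT, Multiset.mem_map, Finset.mem_val, Finset.mem_filter, Finset.mem_product,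
    Finset.mem_Icc]
  constructor
  · intro h i j h1 h2 h3
    exact h _ ⟨(i, j), by simp only; omega, rfl⟩
  · rintro h _ ⟨⟨i, j⟩, hij, rfl⟩
    exact h i j (by omega) (by omega) (by omega)

/-- The families `a`, `b`, `e`, `f` of elements of a monoid satisfy the defining relations, where
`e n` and `f 1` are the identity. -/
structure Relations {M : Type*} [Monoid M] (n : ℕ) (a b e f : ℕ → M) : Prop where
  e_top : e n = 1
  f_one : f 1 = 1
  a_a_last : ∀ i, 1 ≤ i → i ≤ n - 1 → a i * a (n - 1) = a i
  a_a : ∀ i j, 1 ≤ i → i ≤ j → j ≤ n - 2 → a i * a j = a (j + 1) * a i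
  b_b_one : ∀ i, 1 ≤ i → i ≤ n - 1 → b i * b 1 = b i
  b_b : ∀ i j, 1 ≤ i → i ≤ j → j ≤ n - 2 → b i * b (j + 1) = b (j + 1) * b (i + 1)
  e_sq : ∀ i, 1 ≤ i → i ≤ n - 1 → e i ^ 2 = e i
  f_sq : ∀ i, 1 ≤ i → i ≤ n - 1 → f (i + 1) ^ 2 = f (i + 1)
  e_f_comm : ∀ j i, 2 ≤ j → j ≤ i → i ≤ n - 1 → e i * f j = f j * e i
  e_f_succ : ∀ i, 1 ≤ i → i ≤ n - 1 → e i * f (i + 1) = f (i + 1) * e i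
  f_succ_e : ∀ i, 1 ≤ i → i ≤ n - 1 → f (i + 1) * e i = e 1 * f n
  e_e_succ : ∀ i, 1 ≤ i → i ≤ n - 2 → e i * e (i + 1) = e (i + 1) * e i
  e_succ_e : ∀ i, 1 ≤ i → i ≤ n - 2 → e (i + 1) * e i = e i
  f_f_succ : ∀ i, 2 ≤ i → i ≤ n - 1 → f i * f (i + 1) = f (i + 1) * f i
  f_succ_f : ∀ i, 2 ≤ i → i ≤ n - 1 → f (i + 1) * f i = f (i + 1)
  a_e_pred : ∀ i, 2 ≤ i → i ≤ n - 1 → a i * e (i - 1) = e (i - 1)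
  a_e : ∀ i j, 1 ≤ i → i ≤ j → j ≤ n - 2 → a i * e j = e (j + 1) * a i
  a_last_e_last : a (n - 1) * e (n - 1) = a (n - 1)
  e_a_self : ∀ i, 1 ≤ i → i ≤ n - 1 → e i * a i = e i
  b_f_add_two : ∀ i, 1 ≤ i → i ≤ n - 2 → b i * f (i + 2) = f (i + 2)
  b_f : ∀ j i, 2 ≤ j → j ≤ i → i ≤ n - 1 → b i * f (j + 1) = f j * b i
  b_one_f_two : b 1 * f 2 = b 1
  f_succ_b : ∀ i, 1 ≤ i → i ≤ n - 1 → f (i + 1) * b i = f (i + 1)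
  a_f_of_le : ∀ j i, 2 ≤ j → j ≤ i → i ≤ n - 1 → a i * f j = f j * a i
  a_f_of_lt : ∀ i j, 1 ≤ i → i < j → j ≤ n - 1 → a i * f j = f (j + 1) * a i
  a_one_f_top : a 1 * f n = e 1 * f n
  a_last_f_top : a (n - 1) * f n = e 1 * f n
  b_e_of_lt : ∀ i j, 1 ≤ i → i < j → j ≤ n - 1 → b i * e j = e j * b i
  b_e_of_le : ∀ j i, 2 ≤ j → j ≤ i → i ≤ n - 1 → b i * e j = e (j - 1) * b i
  b_one_e_one : b 1 * e 1 = f n * e 1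
  b_last_e_one : b (n - 1) * e 1 = f n * e 1
  f_succ_a : ∀ i, 2 ≤ i → i ≤ n - 1 → f (i + 1) * a i = f (i + 1) * a 1
  e_b : ∀ i, 1 ≤ i → i ≤ n - 2 → e i * b i = e i * b (n - 1)
  b_a_comm : ∀ i j, 1 ≤ i → i < j → j ≤ n - 1 → b i * a j = a j * b i
  b_a_one : ∀ i, 1 ≤ i → i ≤ n - 1 → b i * a 1 = a i
  a_b_last : ∀ i, 1 ≤ i → i ≤ n - 1 → a i * b (n - 1) = b i

/-- Used in both directions: with the quotient map `g` it makes the relations available for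
rewriting, and with `eval n` it turns a check on transformations into well-definedness. The extra
fields `e_top` and `f_one` cost nothing, since out-of-range letters are the empty word. -/
theorem relations_iff {n : ℕ} {M : Type*} [Monoid M] (g : Word n →* M) :
    (∀ p ∈ Rbar n, g p.1 = g p.2) ↔
      Relations n (fun i => g (wa n i)) (fun i => g (wb n i)) (fun i => g (we n i))
        (fun i => g (wf n i)) := by
  simp only [Rbar, R1, R1b, R2, R3, R4, R4b, R5, R5b, R6, R6b, R7, Multiset.mem_add, or_imp,
    forall_and, forall_mem_family, forall_mem_familyLE, forall_mem_familyLT,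
    Multiset.mem_singleton, forall_eq, map_mul, map_pow, and_assoc]
  have he : we n n = 1 := dif_neg (by omega)
  have hf : wf n 1 = 1 := dif_neg (by omega)
  constructor
  · rintro ⟨h1, h2, h3, h4, h5, h6, h7, h8, h9, h10, h11, h12, h13, h14, h15, h16, h17, h18, h19,
      h20, h21, h22, h23, h24, h25, h26, h27, h28, h29, h30, h31, h32, h33, h34⟩
    constructor <;> first | assumption | simp [he, hf]
  · rintro ⟨-, -, h1, h2, h3, h4, h5, h6, h7, h8, h9, h10, h11, h12, h13, h14, h15, h16, h17, h18,
      h19, h20, h21, h22, h23, h24, h25, h26, h27, h28, h29, h30, h31, h32, h33, h34⟩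
    refine ⟨h1, h2, h3, h4, h5, h6, h7, h8, h9, h10, h11, h12, h13, h14, h15, h16, h17, h18, h19,
      h20, h21, h22, h23, h24, h25, h26, h27, h28, h29, h30, h31, h32, h33, h34⟩

/-! ### Products in decreasing order of the indices -/

/-- The product of the `a i`, `i ∈ s`, in decreasing order of the indices. -/
def descProd {M : Type*} [Monoid M] (a : ℕ → M) (s : Finset ℕ) : M :=
  ((s.sort (· ≥ ·)).map a).prod

section descProd

variable {M : Type*} [Monoid M] (a : ℕ → M)

theorem sort_union_of_lt {s t : Finset ℕ} (h : ∀ x ∈ s, ∀ y ∈ t, y < x) :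
    (s ∪ t).sort (· ≥ ·) = s.sort (· ≥ ·) ++ t.sort (· ≥ ·) := by
  refine List.Perm.eq_of_pairwise' (r := (· ≥ ·)) (Finset.pairwise_sort _ _) ?_ ?_
  · refine List.pairwise_append.2 ⟨Finset.pairwise_sort _ _, Finset.pairwise_sort _ _, ?_⟩
    intro x hx y hy
    exact (h x ((Finset.mem_sort _).1 hx) y ((Finset.mem_sort _).1 hy)).le
  · refine (List.perm_ext_iff_of_nodup (Finset.sort_nodup _ _) ?_).2 ?_
    · refine List.nodup_append.2 ⟨Finset.sort_nodup _ _, Finset.sort_nodup _ _, ?_⟩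
      intro x hx y hy
      exact (h x ((Finset.mem_sort _).1 hx) y ((Finset.mem_sort _).1 hy)).ne'
    · intro x
      simp

theorem descProd_union {s t : Finset ℕ} (h : ∀ x ∈ s, ∀ y ∈ t, y < x) :
    descProd a (s ∪ t) = descProd a s * descProd a t := by
  simp [descProd, sort_union_of_lt h]

@[simp]
theorem descProd_empty : descProd a ∅ = 1 := by
  simp [descProd]

@[simp]
theorem descProd_singleton (m : ℕ) : descProd a {m} = a m := by
  simp [descProd]

theorem descProd_insert_min {s : Finset ℕ} {m : ℕ} (h : ∀ x ∈ s, m < x) :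
    descProd a (insert m s) = descProd a s * a m := by
  rw [Finset.insert_eq, Finset.union_comm, descProd_union a (by simpa using h),
    descProd_singleton]

theorem descProd_insert_max {s : Finset ℕ} {m : ℕ} (h : ∀ x ∈ s, x < m) :
    descProd a (insert m s) = a m * descProd a s := by
  rw [Finset.insert_eq, descProd_union a (by simpa using h), descProd_singleton]

end descProd

/-! ### Rewriting rules derived from the relations -/

namespace Relations

variable {M : Type*} [Monoid M] {n : ℕ} {a b e f : ℕ → M} (h : Relations n a b e f)
include h

/-- Writing `a (n - 1)` as `b (n - 1) * a 1` lets `a 1` pass the other `a`; then `a 1 * b (n - 1) =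
b 1` commutes with `a j` and is absorbed by `b (n - 1)`. This is the rule that moves `a`s to the
left of the shift. -/
theorem b_last_a {j : ℕ} (h1 : 2 ≤ j) (h2 : j ≤ n - 1) :
    b (n - 1) * a j = a (n - 1) * a (j - 1) * b (n - 1) := by
  obtain ⟨j, rfl⟩ := Nat.exists_eq_add_of_le' h1
  have h3 := h.a_a 1 (j + 1) le_rfl (by omega) (by omega)
  rw [← h.b_a_one (n - 1) (by omega) le_rfl, mul_assoc (b (n - 1)) (a 1)]
  simp only [show j + 2 - 1 = j + 1 by omega]
  rw [h3, mul_assoc, mul_assoc, h.a_b_last 1 le_rfl (by omega),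
    ← h.b_a_comm 1 _ le_rfl (by omega) h2, ← mul_assoc, h.b_b_one _ (by omega) le_rfl]

/-- The relations only compare neighbouring indices; induction on `j` chains them, and `e n = 1`
closes the top end. -/
theorem e_mul_e_of_le {i j : ℕ} (h1 : 1 ≤ i) (hij : i ≤ j) (hj : j ≤ n) :
    e i * e j = e i ∧ e j * e i = e i := by
  induction j, hij using Nat.le_induction with
  | base =>
    by_cases hi : i = n
    · simp [hi, h.e_top]
    · have := h.e_sq i h1 (by omega)
      rw [sq] at this
      exact ⟨this, this⟩
  | succ j hij ih =>
    obtain ⟨h3, h4⟩ := ih (by omega)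
    by_cases hi : j + 1 = n
    · simp [hi, h.e_top]
    · have h5 := h.e_succ_e j (by omega) (by omega)
      have h6 := (h.e_e_succ j (by omega) (by omega)).trans h5
      constructor
      · rw [← h3, mul_assoc, h6]
      · rw [← h4, ← mul_assoc, h5]

theorem e_mul_e {i j : ℕ} (hi : 1 ≤ i) (hi' : i ≤ n) (hj : 1 ≤ j) (hj' : j ≤ n) :
    e i * e j = e (min i j) := by
  rcases le_total i j with hij | hij
  · rw [min_eq_left hij, (h.e_mul_e_of_le hi hij hj').1]
  · rw [min_eq_right hij, (h.e_mul_e_of_le hj hij hi').2]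

theorem f_mul_f_of_le {i j : ℕ} (h1 : 1 ≤ i) (hij : i ≤ j) (hj : j ≤ n) :
    f i * f j = f j ∧ f j * f i = f j := by
  induction j, hij using Nat.le_induction with
  | base =>
    obtain ⟨i, rfl⟩ := Nat.exists_eq_add_of_le' h1
    rcases Nat.eq_zero_or_pos i with rfl | hi
    · simp [h.f_one]
    · have := h.f_sq i hi (by omega)
      rw [sq] at this
      exact ⟨this, this⟩
  | succ j hij ih =>
    obtain ⟨h3, h4⟩ := ih (by omega)
    by_cases hi : j = 1
    · obtain rfl : i = 1 := by omega
      simp [h.f_one]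
    · have h5 := h.f_succ_f j (by omega) (by omega)
      have h6 := (h.f_f_succ j (by omega) (by omega)).trans h5
      constructor
      · rw [← h6, ← mul_assoc, h3]
      · rw [← h5, mul_assoc, h4]

theorem f_mul_f {i j : ℕ} (hi : 1 ≤ i) (hi' : i ≤ n) (hj : 1 ≤ j) (hj' : j ≤ n) :
    f i * f j = f (max i j) := by
  rcases le_total i j with hij | hij
  · rw [max_eq_right hij, (h.f_mul_f_of_le hi hij hj').1]
  · rw [max_eq_left hij, (h.f_mul_f_of_le hj hij hi').2]

theorem e_f_of_lt {i j : ℕ} (hi : 1 ≤ i) (hij : i < j) (hj : j ≤ n) :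
    e i * f j = e 1 * f n := by
  rw [← (h.f_mul_f_of_le (i := i + 1) (by omega) hij hj).1, ← mul_assoc,
    h.e_f_succ i hi (by omega), h.f_succ_e i hi (by omega), mul_assoc,
    (h.f_mul_f_of_le (by omega) hj le_rfl).2]

theorem f_e_of_lt {i j : ℕ} (hi : 1 ≤ i) (hij : i < j) (hj : j ≤ n) :
    f j * e i = e 1 * f n := by
  -- The zero element is rewritten with `f n` in front, so that it absorbs `f j` from the left.
  have h1 := h.f_succ_e (n - 1) (by omega) le_rfl
  rw [Nat.sub_add_cancel (by omega)] at h1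
  rw [← (h.f_mul_f_of_le (i := i + 1) (by omega) hij hj).2, mul_assoc,
    h.f_succ_e i hi (by omega), ← h1, ← mul_assoc, (h.f_mul_f_of_le (by omega) hj le_rfl).1]

theorem e_f_commute {i j : ℕ} (hi : 1 ≤ i) (hi' : i ≤ n) (hj : 1 ≤ j) (hj' : j ≤ n) :
    e i * f j = f j * e i := by
  rcases lt_or_ge i j with hij | hij
  · rw [h.e_f_of_lt hi hij hj', h.f_e_of_lt hi hij hj']
  by_cases h1 : j = 1
  · simp [h1, h.f_one]
  by_cases h2 : i = n
  · simp [h2, h.e_top]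
  exact h.e_f_comm j i (by omega) hij (by omega)

theorem e_f_mul_e_f {i j p q : ℕ} (hi : 1 ≤ i) (hi' : i ≤ n) (hj : 1 ≤ j) (hj' : j ≤ n)
    (hp : 1 ≤ p) (hp' : p ≤ n) (hq : 1 ≤ q) (hq' : q ≤ n) :
    e i * f j * (e p * f q) = e (min i p) * f (max j q) := by
  rw [mul_assoc, ← mul_assoc (f j), ← h.e_f_commute hp hp' hj hj', mul_assoc, ← mul_assoc (e i),
    h.e_mul_e hi hi' hp hp', h.f_mul_f hj hj' hq hq']

theorem a_e_of_le {u p : ℕ} (hu : 1 ≤ u) (hup : u ≤ p) (hp : p ≤ n - 1) :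
    a u * e p = e (p + 1) * a u := by
  by_cases hp' : p = n - 1
  · rw [hp', Nat.sub_add_cancel (by omega), h.e_top, one_mul]
    -- At the boundary `e (p + 1)` is the identity; exposing a trailing `a (n - 1)` gives a factor
    -- that absorbs `e (n - 1)`.
    nth_rw 1 [← h.a_a_last u hu (by omega)]
    rw [mul_assoc, h.a_last_e_last, h.a_a_last u hu (by omega)]
  · exact h.a_e u p hu hup (by omega)

theorem a_e_of_lt {u p : ℕ} (hp : 1 ≤ p) (hup : p < u) (hu : u ≤ n - 1) :
    a u * e p = e p := by
  rw [← (h.e_mul_e_of_le (j := u - 1) hp (by omega) (by omega)).2, ← mul_assoc,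
    h.a_e_pred u (by omega) hu]

theorem e_a {i m : ℕ} (hi : 1 ≤ i) (him : i ≤ m) (hm : m ≤ n - 1) : e i * a m = e i := by
  rw [← (h.e_mul_e_of_le hi him (by omega)).1, mul_assoc, h.e_a_self m (by omega) hm]

theorem a_f_le {u q : ℕ} (hq : 1 ≤ q) (hqu : q ≤ u) (hu : u ≤ n - 1) :
    a u * f q = f q * a u := by
  by_cases h1 : q = 1
  · simp [h1, h.f_one]
  · exact h.a_f_of_le q u (by omega) hqu hu

/-- The value `n` is never taken by `a u`. Only `u = 1` and `u = n - 1` are listed; the other cases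
follow by exposing a trailing `a (n - 1)`. -/
theorem a_f_top {u : ℕ} (hu : 1 ≤ u) (hu' : u ≤ n - 1) : a u * f n = e 1 * f n := by
  by_cases h1 : u = 1
  · rw [h1, h.a_one_f_top]
  · rw [← h.a_a_last u hu hu', mul_assoc, h.a_last_f_top, ← mul_assoc,
      h.a_e_of_lt le_rfl (by omega) hu']

theorem b_last_e_one' (hn : 2 ≤ n) : b (n - 1) * e 1 = e 1 * f n := by
  rw [h.b_last_e_one, h.e_f_commute le_rfl (by omega) (by omega) le_rfl]

theorem b_last_f {m : ℕ} (hm : 2 ≤ m) (hm' : m ≤ n) :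
    b (n - 1) * f m = f (m - 1) * b (n - 1) := by
  by_cases h2 : m = 2
  · subst h2
    simp only [Nat.add_one_sub_one, h.f_one, one_mul]
    nth_rw 1 [← h.b_b_one (n - 1) (by omega) le_rfl]
    rw [mul_assoc, h.b_one_f_two, h.b_b_one (n - 1) (by omega) le_rfl]
  · have := h.b_f (m - 1) (n - 1) (by omega) (by omega) le_rfl
    rwa [Nat.sub_add_cancel (by omega)] at this

/-- Above its index, every `a m` is the same downward shift. -/
theorem f_a_of_lt {j m : ℕ} (hm : 1 ≤ m) (hmj : m < j) (hj : j ≤ n) : f j * a m = f j * a 1 := by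
  by_cases h1 : m = 1
  · rw [h1]
  · rw [← (h.f_mul_f_of_le (i := m + 1) (by omega) hmj hj).2, mul_assoc,
      h.f_succ_a m (by omega) (by omega), mul_assoc]

theorem f_a_one_b {j : ℕ} (hj : 2 ≤ j) (hj' : j ≤ n) : f j * a 1 * b (n - 1) = f j := by
  have h1 := h.f_succ_b (j - 1) (by omega) (by omega)
  rw [Nat.sub_add_cancel (by omega)] at h1
  rw [← h.f_a_of_lt (m := j - 1) (by omega) (by omega) hj', mul_assoc,
    h.a_b_last (j - 1) (by omega) (by omega), h1]

theorem f_a_one {j : ℕ} (hj : 3 ≤ j) (hj' : j ≤ n) : f j * a 1 = a 1 * f (j - 1) := by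
  have := h.a_f_of_lt 1 (j - 1) le_rfl (by omega) (by omega)
  rwa [Nat.sub_add_cancel (by omega), eq_comm] at this

theorem f_mul_a_one_pow {j t : ℕ} (ht : t + 2 ≤ j) (hj : j ≤ n) :
    f j * a 1 ^ t = a 1 ^ t * f (j - t) := by
  induction t with
  | zero => simp
  | succ t ih =>
    rw [pow_succ, ← mul_assoc, ih (by omega), mul_assoc, h.f_a_one (by omega) (by omega),
      mul_assoc, Nat.sub_sub]

/-- As long as `{j, …, n}` is not pushed below `1`, shifting down and up again changes nothing. This
permits raising the exponent of `a 1` to the canonical `j - 1`. -/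
theorem f_mul_a_one_pow_add {j t d : ℕ} (ht : t + d + 1 ≤ j) (hj : j ≤ n) :
    f j * a 1 ^ t = f j * a 1 ^ (t + d) * b (n - 1) ^ d := by
  induction d with
  | zero => simp
  | succ d ih =>
    rw [ih (by omega), h.f_mul_a_one_pow (t := t + d) (by omega) hj,
      ← h.f_a_one_b (j := j - (t + d)) (by omega) (by omega), ← mul_assoc, ← mul_assoc,
      ← h.f_mul_a_one_pow (t := t + d) (by omega) hj, mul_assoc (f j), ← pow_succ,
      mul_assoc _ (b (n - 1)), ← pow_succ', add_assoc]

/-- Letters `a m` with `m ≥ i` fix `{1, …, i}`. They stand leftmost in a decreasing product, so `e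
i` removes them one at a time. -/
theorem e_mul_descProd {i : ℕ} (hi : 1 ≤ i) (s : Finset ℕ) (hs : ∀ x ∈ s, x ≤ n - 1) :
    e i * descProd a s = e i * descProd a (s.filter (· < i)) := by
  induction s using Finset.induction_on_max with
  | empty => simp
  | insert m s hm ih =>
    by_cases hmi : m < i
    · congr 2
      symm
      rw [Finset.filter_eq_self]
      intro x hx
      rcases Finset.mem_insert.1 hx with rfl | hx
      · exact hmi
      · exact (hm x hx).trans hmi
    · rw [descProd_insert_max a hm, ← mul_assoc, h.e_a hi (by omega) (hs m (by simp)),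
        ih fun x hx => hs x (by simp [hx]), Finset.filter_insert, if_neg hmi]

theorem f_mul_descProd_of_le {j : ℕ} (hj : 1 ≤ j) (s : Finset ℕ)
    (hs : ∀ x ∈ s, j ≤ x ∧ x ≤ n - 1) : f j * descProd a s = descProd a s * f j := by
  induction s using Finset.induction_on_max with
  | empty => simp
  | insert m s hm ih =>
    have hm' := hs m (by simp)
    rw [descProd_insert_max a hm, ← mul_assoc, ← h.a_f_le hj hm'.1 hm'.2, mul_assoc,
      ih fun x hx => hs x (by simp [hx]), mul_assoc]

theorem f_mul_descProd_of_lt {j : ℕ} (hj : j ≤ n) (s : Finset ℕ)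
    (hs : ∀ x ∈ s, 1 ≤ x ∧ x < j) : f j * descProd a s = f j * a 1 ^ s.card := by
  induction s using Finset.induction_on_max generalizing j with
  | empty => simp
  | insert m s hm ih =>
    have hm' := hs m (by simp)
    have hms : m ∉ s := fun h => (hm m h).false
    rw [descProd_insert_max a hm, ← mul_assoc, h.f_a_of_lt hm'.1 hm'.2 hj,
      Finset.card_insert_of_notMem hms, pow_succ', ← mul_assoc]
    -- A further element below `m` forces `j ≥ 3`, which is what moving `f j` past `a 1` requires.
    -- The remaining indices are below `m`, hence below `j - 1`.
    rcases s.eq_empty_or_nonempty with rfl | ⟨x, hx⟩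
    · simp
    · have hx1 := hs x (by simp [hx])
      have hx2 := hm x hx
      rw [h.f_a_one (by omega) hj, mul_assoc, mul_assoc, ih (by omega)]
      intro y hy
      have hy1 := hs y (by simp [hy])
      have hy2 := hm y hy
      omega

/-- Each factor merges two neighbouring points, so the image is `{1, …, n - s.card}`. This makes a
restriction appear in the middle of a word, where the shift rules need one. -/
theorem descProd_mul_e (s : Finset ℕ) (hs : s ⊆ Finset.Icc 1 (n - 1)) :
    descProd a s * e (n - s.card) = descProd a s := by
  induction s using Finset.induction_on_min with
  | empty => simp [h.e_top]
  | insert m s hm ih =>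
    have hms : m ∉ s := fun h => (hm m h).false
    have hm' := Finset.mem_Icc.1 (hs (Finset.mem_insert_self m s))
    have hcard : s.card ≤ (Finset.Icc (m + 1) (n - 1)).card := Finset.card_le_card fun x hx =>
      Finset.mem_Icc.2 ⟨hm x hx, (Finset.mem_Icc.1 (hs (Finset.mem_insert_of_mem hx))).2⟩
    rw [Nat.card_Icc] at hcard
    rw [descProd_insert_min a hm, Finset.card_insert_of_notMem hms, mul_assoc,
      h.a_e_of_le hm'.1 (by omega) (by omega), ← mul_assoc,
      show n - (s.card + 1) + 1 = n - s.card by omega,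
      ih fun x hx => hs (Finset.mem_insert_of_mem hx)]

/-- Insertion sort: passing a factor `a m` with `m ≤ q` raises `q` by one, until the index fits
below the remaining factors. It then differs from every index already present. -/
theorem descProd_mul_a (s : Finset ℕ) {lo q : ℕ} (hlo : 1 ≤ lo) (hs : s ⊆ Finset.Icc lo (n - 1))
    (hq : lo ≤ q) (hq' : q < n - s.card) :
    ∃ p ∉ s, lo ≤ p ∧ p ≤ n - 1 ∧ descProd a s * a q = descProd a (insert p s) := by
  induction s using Finset.induction_on_min generalizing lo q with
  | empty => exact ⟨q, by simp, hq, by omega, by simp⟩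
  | insert m s hm ih =>
    have hms : m ∉ s := fun h => (hm m h).false
    have hm' := Finset.mem_Icc.1 (hs (Finset.mem_insert_self m s))
    rw [Finset.card_insert_of_notMem hms] at hq'
    rcases lt_or_ge q m with hqm | hqm
    · have hlt : ∀ x ∈ insert m s, q < x := by
        intro x hx
        rcases Finset.mem_insert.1 hx with rfl | hx
        · exact hqm
        · exact hqm.trans (hm x hx)
      exact ⟨q, fun hx => (hlt q hx).false, hq, by omega, (descProd_insert_min a hlt).symm⟩
    -- The raised lower bound `m + 1` forces `p > m`, so `m` is still the smallest index and stays
    -- last.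
    · obtain ⟨p, hp, hp1, hp2, hp3⟩ := ih (lo := m + 1) (q := q + 1) (by omega)
        (fun x hx => Finset.mem_Icc.2
          ⟨hm x hx, (Finset.mem_Icc.1 (hs (Finset.mem_insert_of_mem hx))).2⟩) (by omega) (by omega)
      refine ⟨p, ?_, by omega, hp2, ?_⟩
      · rw [Finset.mem_insert, not_or]
        exact ⟨by omega, hp⟩
      · rw [descProd_insert_min a hm, mul_assoc, h.a_a m q (by omega) hqm (by omega), ← mul_assoc,
          hp3, Finset.insert_comm, descProd_insert_min a (s := insert p s)]
        intro x hx
        rcases Finset.mem_insert.1 hx with rfl | hx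
        · omega
        · exact hm x hx

theorem e_mul_pow_b {r t : ℕ} (hr : 1 ≤ r) (ht : r + t ≤ n - 1) :
    e r * b (n - 1) ^ t = b (n - 1) ^ t * e (r + t) := by
  induction t with
  | zero => simp
  | succ t ih =>
    have := h.b_e_of_le (r + t + 1) (n - 1) (by omega) (by omega) le_rfl
    rw [Nat.add_sub_cancel] at this
    rw [pow_succ, ← mul_assoc, ih (by omega), mul_assoc, ← this, mul_assoc, add_assoc]

theorem e_mul_pow_b_mul_a_last {r t : ℕ} (hr : 1 ≤ r) (ht : r + t ≤ n - 1) :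
    e r * b (n - 1) ^ t * a (n - 1) = e r * b (n - 1) ^ t := by
  rw [h.e_mul_pow_b hr ht, mul_assoc, h.e_a (by omega) ht le_rfl]

/-- Iterates `b_last_a`. The spurious `a (n - 1)` produced each time is absorbed, because the points
reached so far are at most `r + t ≤ n - 1`. -/
theorem e_mul_pow_b_mul_a_of_lt {r t m : ℕ} (hr : 1 ≤ r) (ht : r + t ≤ n) (htm : t < m)
    (hm : m ≤ n - 1) : e r * b (n - 1) ^ t * a m = e r * a (m - t) * b (n - 1) ^ t := by
  induction t generalizing m with
  | zero => simp
  | succ t ih =>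
    rw [pow_succ, ← mul_assoc, mul_assoc, h.b_last_a (by omega) hm, ← mul_assoc, ← mul_assoc,
      h.e_mul_pow_b_mul_a_last hr (by omega), ih (by omega) (by omega) (by omega), ← mul_assoc,
      Nat.sub_sub, add_comm 1 t]

/-- After `t` shifts every point lies above `m`, so `a m` undoes one shift. -/
theorem e_mul_pow_b_mul_a_of_le {r t m : ℕ} (hr : 1 ≤ r) (ht : r + t ≤ n) (hm : 1 ≤ m)
    (hmt : m ≤ t) : e r * b (n - 1) ^ t * a m = e r * b (n - 1) ^ (t - 1) := by
  induction t generalizing m with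
  | zero => omega
  | succ t ih =>
    by_cases h1 : m = 1
    · rw [h1, pow_succ, ← mul_assoc, mul_assoc, h.b_a_one (n - 1) (by omega) le_rfl,
        h.e_mul_pow_b_mul_a_last hr (by omega), Nat.add_sub_cancel]
    · rw [pow_succ, ← mul_assoc, mul_assoc, h.b_last_a (by omega) (by omega), ← mul_assoc,
        ← mul_assoc, h.e_mul_pow_b_mul_a_last hr (by omega), ih (by omega) (by omega) (by omega),
        mul_assoc, ← pow_succ, Nat.add_sub_cancel, Nat.sub_add_cancel (by omega)]

end Relations

/-! ### Reduction to canonical form -/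

/-- `x` is a product `a iₖ ⋯ a i₁ (b (n-1))^l` with `iₖ > ⋯ > i₁` and `l ≤ k`. -/
def IsFullNormal {M : Type*} [Monoid M] (n : ℕ) (a b : ℕ → M) (x : M) : Prop :=
  ∃ s ⊆ Finset.Icc 1 (n - 1), ∃ l ≤ s.card, x = descProd a s * b (n - 1) ^ l

/-- `x` is the value of a word in canonical form. -/
def IsNormal {M : Type*} [Monoid M] (n : ℕ) (a b e f : ℕ → M) (x : M) : Prop :=
  (∃ (i j l : ℕ) (s : Finset ℕ), 1 ≤ j ∧ j ≤ i ∧ i ≤ n ∧ s ⊆ Finset.Icc j (i - 1) ∧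
      l ≤ n - i + j + s.card - 1 ∧
      x = e i * f j * descProd a s * a 1 ^ (j - 1) * b (n - 1) ^ l) ∨ x = e 1 * f n

namespace Relations

variable {M : Type*} [Monoid M] {n : ℕ} {a b e f : ℕ → M} (h : Relations n a b e f)
include h

/-- With `r = n - s.card` the size of the image, three things can happen: `a m` cancels a shift (`m
≤ l`), acts trivially on the image (`m - l ≥ r`), or merges two of its points and adds an index to
`s`. -/
theorem isFullNormal_mul_a {x : M} (hx : IsFullNormal n a b x) {m : ℕ} (hm : 1 ≤ m)
    (hm' : m ≤ n - 1) : IsFullNormal n a b (x * a m) := by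
  obtain ⟨s, hs, l, hl, rfl⟩ := hx
  have hcard := Finset.card_le_card hs
  rw [Nat.card_Icc] at hcard
  rw [← h.descProd_mul_e s hs, mul_assoc, mul_assoc, ← mul_assoc (e _)]
  rcases le_or_gt m l with hml | hml
  · rw [h.e_mul_pow_b_mul_a_of_le (by omega) (by omega) hm hml, ← mul_assoc, h.descProd_mul_e s hs]
    exact ⟨s, hs, l - 1, by omega, rfl⟩
  · rw [h.e_mul_pow_b_mul_a_of_lt (by omega) (by omega) hml hm']
    rcases le_or_gt (n - s.card) (m - l) with hr | hr
    · rw [h.e_a (by omega) hr (by omega), ← mul_assoc, h.descProd_mul_e s hs]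
      exact ⟨s, hs, l, hl, rfl⟩
    · obtain ⟨p, hp, hp1, hp2, hp3⟩ := h.descProd_mul_a s le_rfl hs (q := m - l) (by omega) hr
      rw [← mul_assoc, ← mul_assoc, h.descProd_mul_e s hs, hp3]
      refine ⟨insert p s, Finset.insert_subset (Finset.mem_Icc.2 ⟨hp1, hp2⟩) hs, l, ?_, rfl⟩
      rw [Finset.card_insert_of_notMem hp]
      omega

theorem isFullNormal_mul_b_last (hn : 2 ≤ n) {x : M} (hx : IsFullNormal n a b x) :
    IsFullNormal n a b (x * b (n - 1)) := by
  obtain ⟨s, hs, l, hl, rfl⟩ := hx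
  have hcard := Finset.card_le_card hs
  rw [Nat.card_Icc] at hcard
  rcases hl.lt_or_eq with hl | rfl
  · exact ⟨s, hs, l + 1, hl, by rw [mul_assoc, pow_succ]⟩
  -- With `l = s.card` the image already reaches `n`, so one more shift merges its two top points.
  -- Splitting the last shift as `a (n - 1) * b (n - 1)` shows the merge, which enlarges `s` along
  -- with the exponent. If `s.card = n - 1`, the map is constant and the two factors cancel.
  nth_rw 2 [← h.a_b_last (n - 1) (by omega) le_rfl]
  rw [← h.descProd_mul_e s hs, mul_assoc, mul_assoc, ← mul_assoc (b _ ^ _), ← mul_assoc (e _),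
    ← mul_assoc (e _)]
  rcases le_or_gt (n - 1) s.card with hml | hml
  · rw [h.e_mul_pow_b_mul_a_of_le (by omega) (by omega) (by omega) hml, mul_assoc, ← pow_succ,
      ← mul_assoc, h.descProd_mul_e s hs, Nat.sub_add_cancel (by omega)]
    exact ⟨s, hs, s.card, le_rfl, rfl⟩
  · rw [h.e_mul_pow_b_mul_a_of_lt (by omega) (by omega) hml le_rfl]
    obtain ⟨p, hp, hp1, hp2, hp3⟩ := h.descProd_mul_a s le_rfl hs (q := n - 1 - s.card)
      (by omega) (by omega)
    rw [mul_assoc, ← pow_succ, ← mul_assoc, ← mul_assoc, h.descProd_mul_e s hs, hp3]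
    exact ⟨insert p s, Finset.insert_subset (Finset.mem_Icc.2 ⟨hp1, hp2⟩) hs, s.card + 1,
      (Finset.card_insert_of_notMem hp).ge, rfl⟩

/-- The indices split at `j` and `i`: those from `i` on disappear, those in between form the
canonical set, and those below `j` only shift `{j, …, n}` down. -/
theorem isNormal_of_isFullNormal {i j : ℕ} (hj : 1 ≤ j) (hji : j ≤ i) (hi : i ≤ n) {x : M}
    (hx : IsFullNormal n a b x) : IsNormal n a b e f (e i * f j * x) := by
  obtain ⟨s, hs, l, hl, rfl⟩ := hx
  set s₀ := s.filter (· < i) with hs₀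
  set s₁ := s₀.filter (j ≤ ·) with hs₁
  set s₂ := s₀.filter (¬ j ≤ ·) with hs₂
  have hs' : ∀ x ∈ s, 1 ≤ x ∧ x ≤ n - 1 := fun x hx => Finset.mem_Icc.1 (hs hx)
  have h₁ : ∀ x ∈ s₁, j ≤ x ∧ x ≤ i - 1 := by
    intro x hx
    simp only [hs₁, hs₀, Finset.mem_filter] at hx
    omega
  have h₂ : ∀ x ∈ s₂, 1 ≤ x ∧ x < j := by
    intro x hx
    simp only [hs₂, hs₀, Finset.mem_filter] at hx
    have := hs' x hx.1.1
    omega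
  have hc₀ : (s.filter (¬ · < i)).card ≤ (Finset.Icc i (n - 1)).card := by
    refine Finset.card_le_card fun x hx => ?_
    rw [Finset.mem_filter] at hx
    have := hs' x hx.1
    exact Finset.mem_Icc.2 (by omega)
  have hc₁ : s₂.card ≤ (Finset.Icc 1 (j - 1)).card := by
    refine Finset.card_le_card fun x hx => ?_
    have := h₂ x hx
    exact Finset.mem_Icc.2 (by omega)
  rw [Nat.card_Icc] at hc₀ hc₁
  have hc₂ : s₀.card + _ = s.card := s.card_filter_add_card_filter_not (p := (· < i))
  have hc₃ : s₁.card + s₂.card = s₀.card := s₀.card_filter_add_card_filter_not (p := (j ≤ ·))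
  have hD : descProd a s₀ = descProd a s₁ * descProd a s₂ := by
    rw [← descProd_union, Finset.filter_union_filter_not_eq]
    intro x hx y hy
    exact (h₂ y hy).2.trans_le (h₁ x hx).1
  -- Padding `a 1 ^ s₂.card` to `a 1 ^ (j - 1)` costs `j - 1 - s₂.card` extra upward shifts. The
  -- bound on the exponent follows from `l ≤ s.card`, as at most `n - i` indices were dropped.
  refine Or.inl ⟨i, j, j - 1 - s₂.card + l, s₁, hj, hji, hi,
    fun x hx => Finset.mem_Icc.2 (h₁ x hx), by omega, ?_⟩
  have hf := h.f_mul_descProd_of_le hj s₁ fun x hx => by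
    have := h₁ x hx
    omega
  calc e i * f j * (descProd a s * b (n - 1) ^ l)
      = f j * (e i * descProd a s) * b (n - 1) ^ l := by
        rw [h.e_f_commute (by omega) hi hj (by omega)]
        simp only [mul_assoc]
    _ = e i * (f j * descProd a s₁) * descProd a s₂ * b (n - 1) ^ l := by
        rw [h.e_mul_descProd (by omega) s fun x hx => (hs' x hx).2, ← hs₀, hD, ← mul_assoc,
          ← h.e_f_commute (by omega) hi hj (by omega)]
        simp only [mul_assoc]
    _ = e i * descProd a s₁ * (f j * descProd a s₂) * b (n - 1) ^ l := by
        rw [hf]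
        simp only [mul_assoc]
    _ = e i * (descProd a s₁ * f j) * a 1 ^ (j - 1) * b (n - 1) ^ (j - 1 - s₂.card)
          * b (n - 1) ^ l := by
        rw [h.f_mul_descProd_of_lt (by omega) s₂ h₂,
          h.f_mul_a_one_pow_add (d := j - 1 - s₂.card) (by omega) (by omega),
          Nat.add_sub_cancel' (by omega)]
        simp only [mul_assoc]
    _ = _ := by
        rw [← hf, pow_add]
        simp only [mul_assoc]

/-- Products of the `a i` and `b (n - 1)` can be moved past `e p * f q`. -/
theorem mul_e_f_mem (hn : 2 ≤ n) {x : M}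
    (hx : x ∈ Submonoid.closure (a '' Set.Icc 1 (n - 1) ∪ {b (n - 1)})) {p q : ℕ}
    (hp : 1 ≤ p) (hp' : p ≤ n) (hq : 1 ≤ q) (hq' : q ≤ n) :
    ∃ p' q', 1 ≤ p' ∧ p' ≤ n ∧ 1 ≤ q' ∧ q' ≤ n ∧
      ∃ y ∈ Submonoid.closure (a '' Set.Icc 1 (n - 1) ∪ {b (n - 1)}),
        x * (e p * f q) = e p' * f q' * y := by
  have hef : ∀ {p' q : ℕ}, 1 ≤ p' → p' ≤ n → 1 ≤ q → q ≤ n →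
      e p' * (e 1 * f n) = e 1 * f n ∧ e 1 * f n * f q = e 1 * f n := by
    intro p' q h1 h2 h3 h4
    rw [← mul_assoc, h.e_mul_e h1 h2 le_rfl (by omega), min_eq_right h1, mul_assoc,
      h.f_mul_f (by omega) le_rfl h3 h4, max_eq_left h4]
    exact ⟨rfl, rfl⟩
  induction hx using Submonoid.closure_induction generalizing p q with
  | one => exact ⟨p, q, hp, hp', hq, hq', 1, one_mem _, by simp⟩
  | mul x y _ _ ihx ihy =>
    obtain ⟨p₁, q₁, h1, h2, h3, h4, y', hy', hy⟩ := ihy hp hp' hq hq'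
    obtain ⟨p₂, q₂, h5, h6, h7, h8, x', hx', hx⟩ := ihx h1 h2 h3 h4
    exact ⟨p₂, q₂, h5, h6, h7, h8, x' * y', mul_mem hx' hy', by
      rw [mul_assoc, hy, ← mul_assoc, hx, mul_assoc]⟩
  | mem x hx =>
    have hxm := Submonoid.subset_closure hx
    rcases hx with ⟨u, ⟨hu, hu'⟩, rfl⟩ | rfl
    · have hF : ∃ q', 1 ≤ q' ∧ q' ≤ n ∧ a u * f q = f q' * a u ∨ a u * f q = e 1 * f n := by
        rcases le_or_gt q u with hqu | hqu
        · exact ⟨q, Or.inl ⟨hq, hq', h.a_f_le hq hqu hu'⟩⟩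
        by_cases hqn : q = n
        · exact ⟨1, Or.inr (hqn ▸ h.a_f_top hu hu')⟩
        · exact ⟨q + 1, Or.inl ⟨by omega, by omega, h.a_f_of_lt u q hu hqu (by omega)⟩⟩
      have hE : ∃ p', 1 ≤ p' ∧ p' ≤ n ∧ (a u * e p = e p' * a u ∨ a u * e p = e p') := by
        rcases lt_or_ge p u with hpu | hpu
        · exact ⟨p, hp, hp', Or.inr (h.a_e_of_lt hp hpu hu')⟩
        by_cases hpn : p = n
        · exact ⟨n, by omega, le_rfl, Or.inl (by rw [hpn, h.e_top, one_mul, mul_one])⟩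
        · exact ⟨p + 1, by omega, by omega, Or.inl (h.a_e_of_le hu hpu (by omega))⟩
      obtain ⟨p', h1, h2, hE | hE⟩ := hE
      · obtain ⟨q', ⟨h3, h4, hF⟩ | hF⟩ := hF
        · exact ⟨p', q', h1, h2, h3, h4, a u, hxm, by
            rw [← mul_assoc, hE, mul_assoc, hF, ← mul_assoc]⟩
        · exact ⟨1, n, le_rfl, by omega, by omega, le_rfl, 1, one_mem _, by
            rw [← mul_assoc, hE, mul_assoc, hF, (hef h1 h2 hq hq').1, mul_one]⟩
      · exact ⟨p', q, h1, h2, hq, hq', 1, one_mem _, by rw [← mul_assoc, hE, mul_one]⟩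
    -- No point is shifted up to `1`, so `p = 1` gives the zero element; the general rule would
    -- produce the index `0`.
    · by_cases hp1 : p = 1
      · exact ⟨1, n, le_rfl, by omega, by omega, le_rfl, 1, one_mem _, by
          rw [hp1, ← mul_assoc, h.b_last_e_one' hn, (hef le_rfl (by omega) hq hq').2, mul_one]⟩
      have hE : ∃ p', 1 ≤ p' ∧ p' ≤ n ∧ b (n - 1) * e p = e p' * b (n - 1) := by
        by_cases hpn : p = n
        · exact ⟨n, by omega, le_rfl, by rw [hpn, h.e_top, one_mul, mul_one]⟩
        · exact ⟨p - 1, by omega, by omega, h.b_e_of_le p (n - 1) (by omega) (by omega) le_rfl⟩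
      have hF : ∃ q', 1 ≤ q' ∧ q' ≤ n ∧ b (n - 1) * f q = f q' * b (n - 1) := by
        by_cases hq1 : q = 1
        · exact ⟨1, le_rfl, by omega, by rw [hq1, h.f_one, one_mul, mul_one]⟩
        · exact ⟨q - 1, by omega, by omega, h.b_last_f (by omega) hq'⟩
      obtain ⟨p', h1, h2, hE⟩ := hE
      obtain ⟨q', h3, h4, hF⟩ := hF
      exact ⟨p', q', h1, h2, h3, h4, b (n - 1), hxm, by
        rw [← mul_assoc, hE, mul_assoc, hF, ← mul_assoc]⟩

theorem isFullNormal_of_mem_closure (hn : 2 ≤ n) {x : M}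
    (hx : x ∈ Submonoid.closure (a '' Set.Icc 1 (n - 1) ∪ {b (n - 1)})) :
    IsFullNormal n a b x := by
  induction hx using Submonoid.closure_induction_right with
  | one => exact ⟨∅, by simp, 0, by simp, by simp⟩
  | mul_right x _ y hy ih =>
    rcases hy with ⟨u, ⟨hu, hu'⟩, rfl⟩ | rfl
    · exact h.isFullNormal_mul_a ih hu hu'
    · exact h.isFullNormal_mul_b_last hn ih

theorem zero_mul_of_mem_closure (hn : 2 ≤ n) {x : M}
    (hx : x ∈ Submonoid.closure (a '' Set.Icc 1 (n - 1) ∪ {b (n - 1)})) :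
    e 1 * f n * x = e 1 * f n := by
  induction hx using Submonoid.closure_induction_right with
  | one => rw [mul_one]
  | mul_right x _ y hy ih =>
    rw [← mul_assoc, ih]
    rcases hy with ⟨u, ⟨hu, hu'⟩, rfl⟩ | rfl
    · rw [h.e_f_commute le_rfl (by omega) (by omega) le_rfl, mul_assoc, h.e_a le_rfl hu hu']
    · have := h.f_succ_b (n - 1) (by omega) le_rfl
      rw [Nat.sub_add_cancel (by omega)] at this
      rw [mul_assoc, this]

/-- Every product of generators can be brought to canonical form. -/
theorem isNormal_of_mem_closure (hn : 2 ≤ n) {x : M}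
    (hx : x ∈ Submonoid.closure (a '' Set.Icc 1 (n - 1) ∪ b '' Set.Icc 1 (n - 1) ∪
      e '' Set.Icc 1 (n - 1) ∪ f '' Set.Icc 2 n)) :
    IsNormal n a b e f x := by
  set C := Submonoid.closure (a '' Set.Icc 1 (n - 1) ∪ {b (n - 1)}) with hC
  have ha : ∀ u, 1 ≤ u → u ≤ n - 1 → a u ∈ C := fun u h1 h2 =>
    Submonoid.subset_closure (Or.inl ⟨u, ⟨h1, h2⟩, rfl⟩)
  have hb : ∀ u, 1 ≤ u → u ≤ n - 1 → b u ∈ C := fun u h1 h2 =>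
    h.a_b_last u h1 h2 ▸ mul_mem (ha u h1 h2) (Submonoid.subset_closure (Or.inr rfl))
  have key : ∃ i j, 1 ≤ i ∧ i ≤ n ∧ 1 ≤ j ∧ j ≤ n ∧ ∃ y ∈ C, x = e i * f j * y := by
    have hef : ∀ i j, 1 ≤ i → i ≤ n → 1 ≤ j → j ≤ n → ∀ y ∈ C, ∀ p q, 1 ≤ p → p ≤ n → 1 ≤ q →
        q ≤ n → ∃ i' j', 1 ≤ i' ∧ i' ≤ n ∧ 1 ≤ j' ∧ j' ≤ n ∧ ∃ y' ∈ C,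
          e i * f j * y * (e p * f q) = e i' * f j' * y' := by
      intro i j hi hi' hj hj' y hy p q hp hp' hq hq'
      obtain ⟨p', q', h1, h2, h3, h4, y', hy', hyy⟩ := h.mul_e_f_mem hn hy hp hp' hq hq'
      refine ⟨min i p', max j q', by omega, by omega, by omega, by omega, y', hy', ?_⟩
      rw [mul_assoc, hyy, ← mul_assoc, h.e_f_mul_e_f hi hi' hj hj' h1 h2 h3 h4]
    induction hx using Submonoid.closure_induction_right with
    | one => exact ⟨n, 1, by omega, le_rfl, le_rfl, by omega, 1, one_mem _, by
        simp [h.e_top, h.f_one]⟩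
    | mul_right x _ y hy ih =>
      obtain ⟨i, j, hi, hi', hj, hj', z, hz, rfl⟩ := ih
      rcases hy with ((⟨u, ⟨hu, hu'⟩, rfl⟩ | ⟨u, ⟨hu, hu'⟩, rfl⟩) | ⟨u, ⟨hu, hu'⟩, rfl⟩) |
        ⟨u, ⟨hu, hu'⟩, rfl⟩
      · exact ⟨i, j, hi, hi', hj, hj', z * a u, mul_mem hz (ha u hu hu'), mul_assoc _ _ _⟩
      · exact ⟨i, j, hi, hi', hj, hj', z * b u, mul_mem hz (hb u hu hu'), mul_assoc _ _ _⟩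
      -- A single `e u` is treated as `e u * f 1`, and below a single `f u` as `e n * f u`.
      · simpa [h.f_one] using
          hef i j hi hi' hj hj' z hz u 1 hu (by omega) le_rfl (by omega)
      · simpa [h.e_top] using
          hef i j hi hi' hj hj' z hz n u (by omega) le_rfl (by omega) hu'
  obtain ⟨i, j, hi, hi', hj, hj', y, hy, rfl⟩ := key
  rcases lt_or_ge i j with hij | hij
  · rw [h.e_f_of_lt hi hij hj', h.zero_mul_of_mem_closure hn hy]
    exact Or.inr rfl
  · exact h.isNormal_of_isFullNormal hj hij hi' (h.isFullNormal_of_mem_closure hn hy)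

end Relations

/-! ### Transformations as partial functions on numbers -/

/-- On numbers, the partial transformation `α` acts as `g`. -/
def ActsAs {n : ℕ} (α : IntervalMonoid n) (g : ℕ → Option ℕ) : Prop :=
  ∀ x : Chain n, (α.1.map x).map Subtype.val = g x.1

namespace ActsAs

variable {n : ℕ} {α β : IntervalMonoid n} {g k : ℕ → Option ℕ}

theorem mul (hα : ActsAs α g) (hβ : ActsAs β k) : ActsAs (α * β) (fun x => (g x).bind k) := by
  intro x
  change ((α.1.map x).bind β.1.map).map Subtype.val = (g x.1).bind k
  rw [← hα x]
  cases α.1.map x with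
  | none => rfl
  | some y => exact hβ y

theorem one : ActsAs (1 : IntervalMonoid n) some := fun _ => rfl

theorem congr (hα : ActsAs α g) (h : ∀ x, 1 ≤ x → x ≤ n → g x = k x) : ActsAs α k :=
  fun x => (hα x).trans (h x.1 x.2.1 x.2.2)

theorem eq (hα : ActsAs α g) (hβ : ActsAs β k) (h : ∀ x, 1 ≤ x → x ≤ n → g x = k x) :
    α = β :=
  Subtype.ext (PT.ext (funext fun x => Option.map_injective Subtype.val_injective
    ((hα x).trans ((h x.1 x.2.1 x.2.2).trans (hβ x).symm))))

theorem unique (hα : ActsAs α g) (hα' : ActsAs α k) {x : ℕ} (h1 : 1 ≤ x) (h2 : x ≤ n) :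
    g x = k x :=
  (hα ⟨x, h1, h2⟩).symm.trans (hα' ⟨x, h1, h2⟩)

end ActsAs

/-- The action of a letter on numbers. -/
def letterAct {n : ℕ} : Letter n → ℕ → Option ℕ
  | .a i => fun x => if x ≤ i.1 then some x else some (x - 1)
  | .b i => fun x => if x ≤ i.1 then some (x + 1) else some x
  | .e i => fun x => if x ≤ i.1 then some x else none
  | .f j => fun x => if j.1 ≤ x then some x else none

theorem actsAs_gen {n : ℕ} (x : Letter n) : ActsAs (gen n x) (letterAct x) := by
  intro z
  rcases x with i | i | i | j <;> simp only [gen, genPT, letterAct] <;> split_ifs <;> rfl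

/-- The values at `1` and `n` separate the four kinds. Within a kind, the index shows at the point
where the behaviour changes: `i + 1` for `a`, `b`, `e`, and `i` for `f`. -/
theorem gen_injective (n : ℕ) (hn : 2 ≤ n) : Function.Injective (gen n) := by
  intro x y hxy
  have H : ∀ z, 1 ≤ z → z ≤ n → letterAct x z = letterAct y z := fun z h1 h2 =>
    (actsAs_gen x).unique (hxy ▸ actsAs_gen y) h1 h2
  have H1 := H 1 le_rfl (by omega)
  have Hn := H n (by omega) le_rfl
  rcases x with ⟨i, hi⟩ | ⟨i, hi⟩ | ⟨i, hi⟩ | ⟨i, hi⟩ <;>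
    rcases y with ⟨j, hj⟩ | ⟨j, hj⟩ | ⟨j, hj⟩ | ⟨j, hj⟩ <;>
    simp only [letterAct, Letter.a.injEq, Letter.b.injEq, Letter.e.injEq, Letter.f.injEq,
      Subtype.mk.injEq, reduceCtorEq] at H H1 Hn ⊢
  case a.a | b.b | e.e =>
    have Hi := H (i + 1) (by omega) (by omega)
    have Hj := H (j + 1) (by omega) (by omega)
    grind
  case f.f =>
    have Hi := H i (by omega) (by omega)
    have Hj := H j (by omega) (by omega)
    grind
  all_goals grind

theorem card_letter (n : ℕ) (hn : 2 ≤ n) : Nat.card (Letter n) = 4 * n - 4 := by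
  let I := {i : ℕ // 1 ≤ i ∧ i ≤ n - 1}
  let J := {j : ℕ // 2 ≤ j ∧ j ≤ n}
  let E : Letter n ≃ (I ⊕ I) ⊕ (I ⊕ J) :=
    { toFun := fun x => match x with
        | .a i => .inl (.inl i)
        | .b i => .inl (.inr i)
        | .e i => .inr (.inl i)
        | .f j => .inr (.inr j)
      invFun := fun x => match x with
        | .inl (.inl i) => .a i
        | .inl (.inr i) => .b i
        | .inr (.inl i) => .e i
        | .inr (.inr j) => .f j
      left_inv := by rintro (i | i | i | j) <;> rfl
      right_inv := by rintro ((i | i) | (i | j)) <;> rfl }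
  have hI : Nat.card I = n - 1 := by
    rw [Nat.subtype_card (Finset.Icc 1 (n - 1)) (by simp), Nat.card_Icc, Nat.add_sub_cancel]
  have hJ : Nat.card J = n - 1 := by
    rw [Nat.subtype_card (Finset.Icc 2 n) (by simp), Nat.card_Icc]
    rfl
  have : Finite I := Nat.finite_of_card_ne_zero (by omega)
  have : Finite J := Nat.finite_of_card_ne_zero (by omega)
  rw [Nat.card_congr E, Nat.card_sum, Nat.card_sum, Nat.card_sum, hI, hJ]
  omega

/-- The value of a word. -/
def eval (n : ℕ) : Word n →* IntervalMonoid n := FreeMonoid.lift (gen n)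

theorem eval_of (n : ℕ) (x : Letter n) : eval n (FreeMonoid.of x) = gen n x :=
  FreeMonoid.lift_eval_of _ _

theorem actsAs_wa {n i : ℕ} (h1 : 1 ≤ i) (h2 : i ≤ n - 1) :
    ActsAs (eval n (wa n i)) (fun x => if x ≤ i then some x else some (x - 1)) := by
  rw [wa, dif_pos ⟨h1, h2⟩, eval_of]
  exact actsAs_gen _

theorem actsAs_wb {n i : ℕ} (h1 : 1 ≤ i) (h2 : i ≤ n - 1) :
    ActsAs (eval n (wb n i)) (fun x => if x ≤ i then some (x + 1) else some x) := by
  rw [wb, dif_pos ⟨h1, h2⟩, eval_of]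
  exact actsAs_gen _

theorem actsAs_we {n i : ℕ} (h1 : 1 ≤ i) (h2 : i ≤ n) :
    ActsAs (eval n (we n i)) (fun x => if x ≤ i then some x else none) := by
  by_cases hi : i ≤ n - 1
  · rw [we, dif_pos ⟨h1, hi⟩, eval_of]
    exact actsAs_gen _
  · rw [we, dif_neg (by omega), map_one]
    exact ActsAs.one.congr fun x _ _ => (if_pos (by omega)).symm

theorem actsAs_wf {n j : ℕ} (h1 : 1 ≤ j) (h2 : j ≤ n) :
    ActsAs (eval n (wf n j)) (fun x => if j ≤ x then some x else none) := by
  by_cases hj : 2 ≤ j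
  · rw [wf, dif_pos ⟨hj, h2⟩, eval_of]
    exact actsAs_gen _
  · rw [wf, dif_neg (by omega), map_one]
    exact ActsAs.one.congr fun x _ _ => (if_pos (by omega)).symm

/-- The transformations satisfy the defining relations. -/
theorem relations_eval (n : ℕ) (hn : 2 ≤ n) :
    Relations n (fun i => eval n (wa n i)) (fun i => eval n (wb n i)) (fun i => eval n (we n i))
      (fun i => eval n (wf n i)) := by
  constructor
  case e_top => rw [we, dif_neg (by omega), map_one]
  case f_one => rw [wf, dif_neg (by omega), map_one]
  -- Each side has at most two letters, so composing their actions leaves a case split on the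
  -- position of `x` relative to the indices.
  all_goals
    intros
    try rw [sq]
    with_reducible apply ActsAs.eq
    case hα =>
      try with_reducible apply ActsAs.mul
      all_goals
        with_reducible first | apply actsAs_wa | apply actsAs_wb | apply actsAs_we |
          apply actsAs_wf
        all_goals omega
    case hβ =>
      try with_reducible apply ActsAs.mul
      all_goals
        with_reducible first | apply actsAs_wa | apply actsAs_wb | apply actsAs_we |
          apply actsAs_wf
        all_goals omega
    case h =>
      intro x hx hx'
      split_ifs <;> simp only [Option.bind_some, Option.bind_none] <;> (try split_ifs) <;>
        first | rfl | (simp only [Option.some.injEq, reduceCtorEq]; omega) | omega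

theorem map_descProd {M N : Type*} [Monoid M] [Monoid N] (g : M →* N) (a : ℕ → M)
    (s : Finset ℕ) : g (descProd a s) = descProd (fun i => g (a i)) s := by
  rw [descProd, descProd, map_list_prod, List.map_map]
  rfl

/-! ### Values of the canonical words -/

/-- The number of elements of `s` below `x`. -/
def countBelow (s : Finset ℕ) (x : ℕ) : ℕ := (s.filter (· < x)).card

theorem countBelow_le {s : Finset ℕ} {j i : ℕ} (hs : s ⊆ Finset.Icc j i) (x : ℕ) :
    countBelow s x ≤ x - j := by
  have : countBelow s x ≤ (Finset.Ico j x).card := Finset.card_le_card fun u hu => by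
    rw [Finset.mem_filter] at hu
    exact Finset.mem_Ico.2 ⟨(Finset.mem_Icc.1 (hs hu.1)).1, hu.2⟩
  rwa [Nat.card_Ico] at this

theorem card_le_countBelow_add {s : Finset ℕ} {j i : ℕ} (hs : s ⊆ Finset.Icc j (i - 1)) (x : ℕ)
    (hi : 1 ≤ i) : s.card ≤ countBelow s x + (i - x) := by
  have h1 : (s.filter (¬ · < x)).card ≤ (Finset.Ico x i).card :=
    Finset.card_le_card fun u hu => by
      rw [Finset.mem_filter] at hu
      have := Finset.mem_Icc.1 (hs hu.1)
      exact Finset.mem_Ico.2 (by omega)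
  rw [Nat.card_Ico] at h1
  have h2 := s.card_filter_add_card_filter_not (p := (· < x))
  rw [countBelow]
  omega

theorem countBelow_succ (s : Finset ℕ) (x : ℕ) :
    countBelow s (x + 1) = countBelow s x + if x ∈ s then 1 else 0 := by
  have : s.filter (· < x + 1) = if x ∈ s then insert x (s.filter (· < x)) else s.filter (· < x) := by
    ext u
    split_ifs with h
    · simp only [Finset.mem_filter, Finset.mem_insert]
      constructor
      · rintro ⟨h1, h2⟩
        rcases (Nat.lt_succ_iff_lt_or_eq.1 h2) with h3 | h3
        · exact Or.inr ⟨h1, h3⟩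
        · exact Or.inl h3
      · rintro (rfl | ⟨h1, h2⟩)
        · exact ⟨h, Nat.lt_succ_self _⟩
        · exact ⟨h1, by omega⟩
    · simp only [Finset.mem_filter]
      refine and_congr_right fun hu => ⟨fun hux => ?_, fun hux => by omega⟩
      have : u ≠ x := fun hux => h (hux ▸ hu)
      omega
  rw [countBelow, this]
  split_ifs
  · rw [Finset.card_insert_of_notMem (by simp)]
    rfl
  · rfl

theorem actsAs_descWord {n : ℕ} (s : Finset ℕ) (hs : s ⊆ Finset.Icc 1 (n - 1)) :
    ActsAs (eval n (descWord n s)) (fun x => some (x - countBelow s x)) := by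
  change ActsAs (eval n (descProd (wa n) s)) _
  induction s using Finset.induction_on_min with
  | empty =>
    rw [descProd_empty, map_one]
    exact ActsAs.one.congr fun x _ _ => by simp [countBelow]
  | insert m s hm ih =>
    have hm' := Finset.mem_Icc.1 (hs (Finset.mem_insert_self m s))
    have hs' := (Finset.subset_insert m s).trans hs
    have hs'' : s ⊆ Finset.Icc (m + 1) (n - 1) := fun x hx =>
      Finset.mem_Icc.2 ⟨hm x hx, (Finset.mem_Icc.1 (hs' hx)).2⟩
    rw [descProd_insert_min _ hm, map_mul]
    refine ((ih hs').mul (actsAs_wa hm'.1 hm'.2)).congr fun x _ _ => ?_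
    have h1 := countBelow_le hs'' x
    have h2 : countBelow (insert m s) x = countBelow s x + if m < x then 1 else 0 := by
      rw [countBelow, Finset.filter_insert]
      split_ifs
      · rw [Finset.card_insert_of_notMem fun h => (hm m (Finset.mem_filter.1 h).1).false]
        rfl
      · rfl
    rw [h2, Option.bind_some]
    split_ifs <;> simp only [Option.some.injEq] <;> omega

theorem actsAs_wa_one_pow {n : ℕ} (hn : 2 ≤ n) (t : ℕ) :
    ActsAs (eval n (wa n 1 ^ t)) (fun x => some (max 1 (x - t))) := by
  induction t with
  | zero =>
    rw [pow_zero, map_one]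
    exact ActsAs.one.congr fun x h1 _ => by rw [Nat.sub_zero, max_eq_right h1]
  | succ t ih =>
    rw [pow_succ, map_mul]
    refine (ih.mul (actsAs_wa le_rfl (by omega))).congr fun x _ _ => ?_
    rw [Option.bind_some]
    split_ifs <;> simp only [Option.some.injEq] <;> omega

theorem actsAs_wb_last_pow {n : ℕ} (hn : 2 ≤ n) (t : ℕ) :
    ActsAs (eval n (wb n (n - 1) ^ t)) (fun x => some (min n (x + t))) := by
  induction t with
  | zero =>
    rw [pow_zero, map_one]
    exact ActsAs.one.congr fun x _ h1 => by rw [Nat.add_zero, min_eq_right h1]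
  | succ t ih =>
    rw [pow_succ, map_mul]
    refine (ih.mul (actsAs_wb (by omega) le_rfl)).congr fun x _ _ => ?_
    rw [Option.bind_some]
    split_ifs <;> simp only [Option.some.injEq] <;> omega

/-- The factors truncate at `1` and at `n`, but on `{j, …, i}` neither truncation occurs: at most `x
- j` indices lie below `x`, and the bound on `l` keeps the values at most `n`. -/
theorem actsAs_canonical {n i j l : ℕ} {s : Finset ℕ} (hn : 2 ≤ n) (hj : 1 ≤ j) (hji : j ≤ i)
    (hi : i ≤ n) (hs : s ⊆ Finset.Icc j (i - 1)) (hl : l ≤ n - i + j + s.card - 1) :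
    ActsAs (eval n (we n i * wf n j * descWord n s * wa n 1 ^ (j - 1) * wb n (n - 1) ^ l))
      (fun x => if j ≤ x ∧ x ≤ i then some (x - countBelow s x - (j - 1) + l) else none) := by
  simp only [map_mul]
  refine (((((actsAs_we (by omega) hi).mul (actsAs_wf hj (by omega))).mul
    (actsAs_descWord s (hs.trans (Finset.Icc_subset_Icc hj (by omega))))).mul
    (actsAs_wa_one_pow hn _)).mul (actsAs_wb_last_pow hn _)).congr fun x h1 h2 => ?_
  have h3 := countBelow_le hs x
  have h4 := card_le_countBelow_add hs x (by omega)
  split_ifs <;> simp only [Option.bind_some, Option.bind_none] <;> (try split_ifs) <;>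
    simp only [Option.bind_some, Option.bind_none, Option.some.injEq, reduceCtorEq] <;> omega

theorem actsAs_zero {n : ℕ} (hn : 2 ≤ n) :
    ActsAs (eval n (we n 1 * wf n n)) (fun _ => none) := by
  rw [map_mul]
  refine ((actsAs_we le_rfl (by omega)).mul (actsAs_wf (by omega) le_rfl)).congr
    fun x h1 h2 => ?_
  split_ifs <;> simp only [Option.bind_some, Option.bind_none] <;> (try split_ifs) <;>
    first
    | rfl
    | omega

/-- The domain gives `i` and `j`, the value at `j` gives `l` since no index lies below `j`, and the
jumps of `countBelow` give `s`. -/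
theorem eval_injOn_Wbar (n : ℕ) (hn : 2 ≤ n) : Set.InjOn (eval n) (Wbar n) := by
  rintro w (⟨i, j, l, s, hj, hji, hi, hs, hl, rfl⟩ | rfl) w'
    (⟨i', j', l', s', hj', hji', hi', hs', hl', rfl⟩ | rfl) hww
  · have H' := actsAs_canonical hn hj' hji' hi' hs' hl'
    rw [← hww] at H'
    have H := fun x (h1 : 1 ≤ x) (h2 : x ≤ n) =>
      (actsAs_canonical hn hj hji hi hs hl).unique H' h1 h2
    have dom : ∀ x, 1 ≤ x → x ≤ n → (j ≤ x ∧ x ≤ i ↔ j' ≤ x ∧ x ≤ i') := by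
      intro x h1 h2
      have := H x h1 h2
      split_ifs at this with p q q <;>
        first | exact iff_of_true p q | exact iff_of_false p q
    have d1 := dom i (by omega) hi
    have d2 := dom j hj (by omega)
    have d3 := dom i' (by omega) hi'
    have d4 := dom j' hj' (by omega)
    obtain rfl : i = i' := by omega
    obtain rfl : j = j' := by omega
    have V : ∀ x, j ≤ x → x ≤ i →
        x - countBelow s x - (j - 1) + l = x - countBelow s' x - (j - 1) + l' := by
      intro x h1 h2
      have := H x (by omega) (by omega)
      rwa [if_pos ⟨h1, h2⟩, if_pos ⟨h1, h2⟩, Option.some.injEq] at this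
    have c1 := countBelow_le hs
    have c2 := countBelow_le hs'
    obtain rfl : l = l' := by
      have h1 := V j le_rfl hji
      have h2 := c1 j
      have h3 := c2 j
      omega
    have C : ∀ x, j ≤ x → x ≤ i → countBelow s x = countBelow s' x := by
      intro x h1 h2
      have h3 := V x h1 h2
      have h4 := c1 x
      have h5 := c2 x
      omega
    obtain rfl : s = s' := by
      ext u
      by_cases hu : j ≤ u ∧ u + 1 ≤ i
      · have h1 := C u hu.1 (by omega)
        have h2 := C (u + 1) (by omega) hu.2
        rw [countBelow_succ, countBelow_succ, h1] at h2
        split_ifs at h2 with p q q <;>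
          first | omega | exact iff_of_true p q | exact iff_of_false p q
      · refine iff_of_false (fun h => hu ?_) (fun h => hu ?_)
        · have := Finset.mem_Icc.1 (hs h)
          omega
        · have := Finset.mem_Icc.1 (hs' h)
          omega
    rfl
  · have H := (actsAs_canonical hn hj hji hi hs hl).unique (hww ▸ actsAs_zero hn) hj (by omega)
    rw [if_pos ⟨le_rfl, hji⟩] at H
    cases H
  · have H := (actsAs_canonical hn hj' hji' hi' hs' hl').unique (hww ▸ actsAs_zero hn) hj'
      (by omega)
    rw [if_pos ⟨le_rfl, hji'⟩] at H
    cases H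
  · rfl

theorem eval_surjOn_Wbar (n : ℕ) (hn : 2 ≤ n) : Set.SurjOn (eval n) (Wbar n) Set.univ := by
  intro α _
  obtain ⟨hop, ⟨hdom⟩, ⟨him⟩⟩ := α.2
  rcases α.1.Dom.eq_empty_or_nonempty with hempty | hne
  · refine ⟨_, Or.inr rfl, (actsAs_zero hn).eq (β := α) (k := fun _ => none) ?_
      fun _ _ _ => rfl⟩
    intro x
    cases hx : α.1.map x with
    | none => rfl
    | some y => exact absurd (show x ∈ α.1.Dom from ⟨y, hx⟩) (by simp [hempty])
  have : Finite (Chain n) := inferInstanceAs (Finite (Set.Icc 1 n))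
  obtain ⟨⟨j, hj⟩, hjd, hjmin⟩ := Set.exists_min_image α.1.Dom id (Set.toFinite _) hne
  obtain ⟨⟨i, hi⟩, hid, himax⟩ := Set.exists_max_image α.1.Dom id (Set.toFinite _) hne
  have hji : j ≤ i := hjmin _ hid
  -- The default `0` is never read: only points of `{j, …, i}` enter below, and all of them lie in
  -- the domain.
  let F : ℕ → ℕ := fun x => if h : 1 ≤ x ∧ x ≤ n then ((α.1.map ⟨x, h⟩).map Subtype.val).getD 0
    else 0
  have hF : ∀ x y : Chain n, α.1.map x = some y → F x.1 = y.1 := by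
    intro x y hxy
    simp only [F, dif_pos x.2, hxy]
    rfl
  have hdom' : ∀ x : Chain n, j ≤ x.1 → x.1 ≤ i → ∃ y, α.1.map x = some y :=
    fun x h1 h2 => hdom hjd hid ⟨h1, h2⟩
  have hα : ActsAs α (fun x => if j ≤ x ∧ x ≤ i then some (F x) else none) := by
    intro x
    beta_reduce
    split_ifs with hx
    · obtain ⟨y, hy⟩ := hdom' x hx.1 hx.2
      rw [hF x y hy, hy]
      rfl
    · cases hy : α.1.map x with
      | none => rfl
      | some y => exact absurd ⟨hjmin x ⟨y, hy⟩, himax x ⟨y, hy⟩⟩ hx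
  have hrange : ∀ x, j ≤ x → x ≤ i → 1 ≤ F x ∧ F x ≤ n := by
    intro x h1 h2
    obtain ⟨y, hy⟩ := hdom' ⟨x, by omega, by omega⟩ h1 h2
    have := hF _ _ hy
    simp only at this
    rw [this]
    exact y.2
  have hstep : ∀ x, j ≤ x → x + 1 ≤ i → F x ≤ F (x + 1) ∧ F (x + 1) ≤ F x + 1 := by
    intro x h1 h2
    obtain ⟨y, hy⟩ := hdom' ⟨x, by omega, by omega⟩ h1 (by simp only; omega)
    obtain ⟨z, hz⟩ := hdom' ⟨x + 1, by omega, by omega⟩ (by simp only; omega) h2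
    have hy' := hF _ _ hy
    have hz' := hF _ _ hz
    simp only at hy' hz'
    rw [hy', hz']
    have hyz : y.1 ≤ z.1 := hop _ _ _ _ hy hz (Nat.le_succ x)
    refine ⟨hyz, ?_⟩
    -- If a value were skipped, `y + 1` would have a preimage `t` because the image is an interval,
    -- and monotonicity excludes both `t ≤ x` and `t > x`.
    by_contra hlt
    have hzn := z.2
    obtain ⟨t, ht⟩ := him ⟨_, hy⟩ ⟨_, hz⟩ (a := (⟨y.1 + 1, by omega, by omega⟩ : Chain n))
      ⟨Nat.le_succ y.1, show y.1 + 1 ≤ z.1 by omega⟩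
    rcases le_or_gt t.1 x with htx | htx
    · have : y.1 + 1 ≤ y.1 := hop _ _ _ _ ht hy htx
      omega
    · have : z.1 ≤ y.1 + 1 := hop _ _ _ _ hz ht htx
      omega
  -- The stationary places. Counting them recovers `F` from its first value.
  let s := (Finset.Icc j (i - 1)).filter (fun u => F (u + 1) = F u)
  have hs : s ⊆ Finset.Icc j (i - 1) := Finset.filter_subset _ _
  have hcount : ∀ x, j ≤ x → x ≤ i → F x + countBelow s x = x - j + F j := by
    intro x hx
    induction x, hx using Nat.le_induction with
    | base =>
      intro _
      have := countBelow_le hs j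
      omega
    | succ x hx ih =>
      intro hxi
      have h1 := ih (by omega)
      have h2 := hstep x hx hxi
      have h3 : x ∈ s ↔ F (x + 1) = F x := by
        simp only [s, Finset.mem_filter, Finset.mem_Icc]
        exact and_iff_right (by omega)
      rw [countBelow_succ]
      split_ifs with hxs <;> rw [h3] at hxs <;> omega
  have hFi := hrange i hji le_rfl
  have hFj := hrange j le_rfl hji
  have hsi : countBelow s i ≤ s.card := Finset.card_filter_le _ _
  have hsi' := card_le_countBelow_add hs i (by omega)
  have hci := hcount i hji le_rfl
  have hl : F j - 1 ≤ n - i + j + s.card - 1 := by omega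
  refine ⟨_, Or.inl ⟨i, j, F j - 1, s, hj.1, hji, hi.2, hs, hl, rfl⟩,
    (actsAs_canonical hn hj.1 hji hi.2 hs hl).eq hα fun x _ _ => ?_⟩
  split_ifs with hx
  · have h1 := hcount x hx.1 hx.2
    have h2 := countBelow_le hs x
    have h3 := hrange x hx.1 hx.2
    rw [Option.some.injEq]
    omega
  · rfl

theorem ncard_Wbar (n : ℕ) (hn : 2 ≤ n) : (Wbar n).ncard = Nat.card (IntervalMonoid n) := by
  rw [← Set.ncard_univ]
  exact Set.BijOn.ncard_eq ⟨fun _ _ => Set.mem_univ _, eval_injOn_Wbar n hn, eval_surjOn_Wbar n hn⟩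

/-! ### The presentation -/

theorem exists_mem_Wbar (n : ℕ) (hn : 2 ≤ n) (w : Word n) :
    ∃ w' ∈ Wbar n, conGen (IsRel n) w w' := by
  let g := PresentedMonoid.mk (IsRel n)
  have hR := (relations_iff g).1 fun p hp => PresentedMonoid.mk_eq_mk_of_rel hp
  have hw : g w ∈ Submonoid.closure ((fun i => g (wa n i)) '' Set.Icc 1 (n - 1) ∪
      (fun i => g (wb n i)) '' Set.Icc 1 (n - 1) ∪ (fun i => g (we n i)) '' Set.Icc 1 (n - 1) ∪
      (fun i => g (wf n i)) '' Set.Icc 2 n) := by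
    induction w using FreeMonoid.inductionOn' with
    | one => rw [map_one]; exact one_mem _
    | of_mul x w ih =>
      rw [map_mul]
      refine mul_mem (Submonoid.subset_closure ?_) ih
      rcases x with ⟨i, hi⟩ | ⟨i, hi⟩ | ⟨i, hi⟩ | ⟨i, hi⟩
      · exact Or.inl (Or.inl (Or.inl ⟨i, hi, by simp only [wa, dif_pos hi]⟩))
      · exact Or.inl (Or.inl (Or.inr ⟨i, hi, by simp only [wb, dif_pos hi]⟩))
      · exact Or.inl (Or.inr ⟨i, hi, by simp only [we, dif_pos hi]⟩)
      · exact Or.inr ⟨i, hi, by simp only [wf, dif_pos hi]⟩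
  rcases hR.isNormal_of_mem_closure hn hw with ⟨i, j, l, s, hj, hji, hi, hs, hl, hx⟩ | hx
  · refine ⟨_, Or.inl ⟨i, j, l, s, hj, hji, hi, hs, hl, rfl⟩, PresentedMonoid.mk_eq_mk_iff.1 ?_⟩
    simp only [← map_descProd g, ← map_mul, ← map_pow] at hx
    exact hx
  · refine ⟨_, Or.inr rfl, PresentedMonoid.mk_eq_mk_iff.1 ?_⟩
    rw [← map_mul] at hx
    exact hx

theorem closure_range_gen (n : ℕ) (hn : 2 ≤ n) :
    Submonoid.closure (Set.range (gen n)) = ⊤ := by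
  rw [← FreeMonoid.mrange_lift, MonoidHom.mrange_eq_top]
  intro α
  obtain ⟨w, -, hw⟩ := eval_surjOn_Wbar n hn (Set.mem_univ α)
  exact ⟨w, hw⟩

/-- Every class contains a word of `Wbar n`, on which evaluation is injective, so equal values force
equal classes. -/
theorem exists_presentedMonoid_equiv (n : ℕ) (hn : 2 ≤ n) :
    ∃ φ : PresentedMonoid (IsRel n) ≃* IntervalMonoid n,
      ∀ x : Letter n, φ (PresentedMonoid.of (IsRel n) x) = gen n x := by
  have hrel : ∀ u v : Word n, IsRel n u v → FreeMonoid.lift (gen n) u = FreeMonoid.lift (gen n) v :=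
    fun u v huv => (relations_iff (eval n)).2 (relations_eval n hn) (u, v) huv
  have hmk : ∀ w : Word n,
      PresentedMonoid.lift (gen n) hrel (PresentedMonoid.mk (IsRel n) w) = eval n w := fun _ => rfl
  refine ⟨MulEquiv.ofBijective (PresentedMonoid.lift (gen n) hrel) ⟨?_, ?_⟩, fun x => rfl⟩
  · intro x y hxy
    obtain ⟨u, rfl⟩ := PresentedMonoid.surjective_mk x
    obtain ⟨v, rfl⟩ := PresentedMonoid.surjective_mk y
    obtain ⟨u', hu', hu⟩ := exists_mem_Wbar n hn u
    obtain ⟨v', hv', hv⟩ := exists_mem_Wbar n hn v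
    rw [PresentedMonoid.mk_eq_mk_iff.2 hu, PresentedMonoid.mk_eq_mk_iff.2 hv, hmk, hmk] at hxy
    rw [PresentedMonoid.mk_eq_mk_iff.2 hu, PresentedMonoid.mk_eq_mk_iff.2 hv,
      eval_injOn_Wbar n hn hu' hv' hxy]
  · intro α
    obtain ⟨w, -, hw⟩ := eval_surjOn_Wbar n hn (Set.mem_univ α)
    exact ⟨PresentedMonoid.mk (IsRel n) w, hw⟩

/-! ### The number of relations -/

theorem card_family {n : ℕ} (lo hi : ℕ) (r : ℕ → Word n × Word n) :
    Multiset.card (family lo hi r) = hi + 1 - lo := by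
  rw [family, Multiset.card_map, Finset.card_val, Nat.card_Icc]

/-- Swapping coordinates matches the pairs violating `≤` with the strict ones, and `≤` is `<`
together with the diagonal. The factor `2` avoids division. -/
theorem card_filter_le_and_lt (s : Finset ℕ) :
    2 * ((s ×ˢ s).filter (fun p : ℕ × ℕ => p.1 ≤ p.2)).card = s.card * (s.card + 1) ∧
    2 * ((s ×ˢ s).filter (fun p : ℕ × ℕ => p.1 < p.2)).card + s.card = s.card * s.card := by
  have h1 := (s ×ˢ s).card_filter_add_card_filter_not (p := fun p : ℕ × ℕ => p.1 ≤ p.2)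
  have h2 : ((s ×ˢ s).filter (fun p : ℕ × ℕ => ¬ p.1 ≤ p.2)).card =
      ((s ×ˢ s).filter (fun p : ℕ × ℕ => p.1 < p.2)).card := by
    refine Finset.card_nbij' Prod.swap Prod.swap ?_ ?_ (fun _ _ => rfl) (fun _ _ => rfl) <;>
    · rintro ⟨i, j⟩ h
      simp only [Finset.coe_filter, Finset.mem_product, Set.mem_ofPred_eq, Prod.swap_prod_mk] at h ⊢
      exact ⟨h.1.symm, by omega⟩
  have h3 : ((s ×ˢ s).filter (fun p : ℕ × ℕ => p.1 ≤ p.2)).card =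
      ((s ×ˢ s).filter (fun p : ℕ × ℕ => p.1 < p.2)).card + s.card := by
    rw [← Finset.diag_card s, ← Finset.card_union_of_disjoint]
    · congr 1
      ext ⟨i, j⟩
      simp only [Finset.mem_filter, Finset.mem_product, Finset.mem_union, Finset.mem_diag]
      constructor
      · rintro ⟨⟨h1, h2⟩, h3⟩
        rcases h3.lt_or_eq with h4 | h4
        · exact Or.inl ⟨⟨h1, h2⟩, h4⟩
        · exact Or.inr ⟨h1, h4⟩
      · rintro (⟨h1, h4⟩ | ⟨h1, rfl⟩)
        · exact ⟨h1, h4.le⟩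
        · exact ⟨⟨h1, h1⟩, le_rfl⟩
    · rw [Finset.disjoint_left]
      rintro ⟨i, j⟩ h h'
      exact (Finset.mem_filter.1 h).2.ne (Finset.mem_diag.1 h').2
  rw [Finset.card_product, h2] at h1
  constructor
  · rw [mul_add, ← h1]
    omega
  · rw [← h1]
    omega

theorem card_familyLE {n : ℕ} (lo hi : ℕ) (r : ℕ → ℕ → Word n × Word n) :
    Multiset.card (familyLE lo hi r) = (hi + 1 - lo) * (hi + 1 - lo + 1) / 2 := by
  have := (card_filter_le_and_lt (Finset.Icc lo hi)).1
  rw [Nat.card_Icc] at this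
  rw [familyLE, Multiset.card_map, Finset.card_val]
  omega

theorem card_familyLT {n : ℕ} (lo hi : ℕ) (r : ℕ → ℕ → Word n × Word n) :
    Multiset.card (familyLT lo hi r) = (hi + 1 - lo - 1) * (hi + 1 - lo) / 2 := by
  have := (card_filter_le_and_lt (Finset.Icc lo hi)).2
  rw [Nat.card_Icc] at this
  rw [familyLT, Multiset.card_map, Finset.card_val, Nat.sub_mul, one_mul]
  omega

theorem card_Rbar (n : ℕ) (hn : 2 ≤ n) : Multiset.card (Rbar n) = 5 * n ^ 2 + 3 * n - 10 := by
  obtain ⟨k, rfl⟩ := Nat.exists_eq_add_of_le' hn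
  simp only [Rbar, R1, R1b, R2, R3, R4, R4b, R5, R5b, R6, R6b, R7, Multiset.card_add, card_family,
    card_familyLE, card_familyLT, Multiset.card_singleton]
  simp only [show k + 2 - 1 = k + 1 by omega, show k + 2 - 2 = k by omega,
    Nat.add_sub_cancel]
  -- With `n = k + 2`, every two-index family has `k * (k + 1) / 2 = c` members, so the rest is
  -- linear in `k` and `c`.
  obtain ⟨c, hc⟩ := (Nat.even_mul_succ_self k).two_dvd
  have h1 : 5 * (k + 2) ^ 2 + 3 * (k + 2) = 5 * (k * (k + 1)) + 18 * k + 26 := by ring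
  rw [h1, hc, Nat.mul_div_cancel_left c two_pos]
  omega

/-! ### Distinctness of the relations -/

/-- The kind of a letter, as a number. -/
def Letter.kind {n : ℕ} : Letter n → ℕ
  | .a _ => 1
  | .b _ => 2
  | .e _ => 3
  | .f _ => 4

/-- The index of a letter. -/
def Letter.index {n : ℕ} : Letter n → ℕ
  | .a i => i.1
  | .b i => i.1
  | .e i => i.1
  | .f j => j.1

/-- The kinds of the letters of a word. -/
def kinds {n : ℕ} (w : Word n) : List ℕ := w.toList.map Letter.kind

/-- The indices of the letters of a word. -/
def indices {n : ℕ} (w : Word n) : List ℕ := w.toList.map Letter.index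

section

variable {n : ℕ}

theorem kinds_mul (u v : Word n) : kinds (u * v) = kinds u ++ kinds v := by
  simp [kinds, FreeMonoid.toList_mul]

theorem indices_mul (u v : Word n) : indices (u * v) = indices u ++ indices v := by
  simp [indices, FreeMonoid.toList_mul]

theorem kinds_wa {i : ℕ} (h1 : 1 ≤ i) (h2 : i ≤ n - 1) : kinds (wa n i) = [1] := by
  rw [wa, dif_pos ⟨h1, h2⟩]; rfl

theorem kinds_wb {i : ℕ} (h1 : 1 ≤ i) (h2 : i ≤ n - 1) : kinds (wb n i) = [2] := by
  rw [wb, dif_pos ⟨h1, h2⟩]; rfl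

theorem kinds_we {i : ℕ} (h1 : 1 ≤ i) (h2 : i ≤ n - 1) : kinds (we n i) = [3] := by
  rw [we, dif_pos ⟨h1, h2⟩]; rfl

theorem kinds_wf {j : ℕ} (h1 : 2 ≤ j) (h2 : j ≤ n) : kinds (wf n j) = [4] := by
  rw [wf, dif_pos ⟨h1, h2⟩]; rfl

theorem indices_wa {i : ℕ} (h1 : 1 ≤ i) (h2 : i ≤ n - 1) : indices (wa n i) = [i] := by
  rw [wa, dif_pos ⟨h1, h2⟩]; rfl

theorem indices_wb {i : ℕ} (h1 : 1 ≤ i) (h2 : i ≤ n - 1) : indices (wb n i) = [i] := by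
  rw [wb, dif_pos ⟨h1, h2⟩]; rfl

theorem indices_we {i : ℕ} (h1 : 1 ≤ i) (h2 : i ≤ n - 1) : indices (we n i) = [i] := by
  rw [we, dif_pos ⟨h1, h2⟩]; rfl

theorem indices_wf {j : ℕ} (h1 : 2 ≤ j) (h2 : j ≤ n) : indices (wf n j) = [j] := by
  rw [wf, dif_pos ⟨h1, h2⟩]; rfl

/-- A comparison of the first two indices of the left-hand side, which separates the families of
relations that agree in the kinds of their letters. -/
def sideKey (k : List ℕ × List ℕ) (i j : ℕ) : Bool :=
  if k = ([1, 4], [4, 1]) ∨ k = ([3, 4], [4, 3]) ∨ k = ([2, 3], [3, 2]) then decide (i < j)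
  else if k = ([1, 4], [3, 4]) then decide (i + 1 < j)
  else if k = ([3, 3], [3]) ∨ k = ([4, 4], [4]) ∨ k = ([2, 3], [4, 3]) then decide (j < i)
  else false

/-- An invariant that is constant on each family of relations. -/
def key (p : Word n × Word n) : (List ℕ × List ℕ) × Bool :=
  ((kinds p.1, kinds p.2), sideKey (kinds p.1, kinds p.2) ((indices p.1).getD 0 0)
    ((indices p.1).getD 1 0))

/-- The relations in `s` are pairwise distinct, and their keys are in `K`. -/
def HasKeys (K : List ((List ℕ × List ℕ) × Bool)) (s : Multiset (Word n × Word n)) : Prop :=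
  s.Nodup ∧ ∀ p ∈ s, key p ∈ K

/-- Disjointness of lists of relations becomes disjointness of explicit finite lists of keys, which
is decidable independently of `n`. -/
theorem HasKeys.add {K L : List ((List ℕ × List ℕ) × Bool)} {s t : Multiset (Word n × Word n)}
    (hs : HasKeys K s) (ht : HasKeys L t) (h : ∀ k ∈ L, k ∉ K) : HasKeys (K ++ L) (s + t) := by
  refine ⟨Multiset.nodup_add.2 ⟨hs.1, ht.1, Multiset.disjoint_left.2 fun hp hp' =>
    h _ (ht.2 _ hp') (hs.2 _ hp)⟩, fun p hp => ?_⟩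
  rcases Multiset.mem_add.1 hp with hp | hp
  · exact List.mem_append_left _ (hs.2 p hp)
  · exact List.mem_append_right _ (ht.2 p hp)

theorem hasKeys_singleton {k : (List ℕ × List ℕ) × Bool} {p : Word n × Word n} (h : key p = k) :
    HasKeys [k] {p} :=
  ⟨Multiset.nodup_singleton _, by simp [h]⟩

theorem hasKeys_family {k : (List ℕ × List ℕ) × Bool} {lo hi : ℕ} {r : ℕ → Word n × Word n}
    (h : ∀ i, lo ≤ i → i ≤ hi → key (r i) = k)
    (h' : ∀ i i', lo ≤ i → i ≤ hi → lo ≤ i' → i' ≤ hi → indices (r i).1 = indices (r i').1 →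
      i = i') : HasKeys [k] (family lo hi r) := by
  refine ⟨Multiset.Nodup.map_on ?_ (Finset.nodup _), ?_⟩
  · intro i hi i' hi' hii
    rw [Finset.mem_val, Finset.mem_Icc] at hi hi'
    exact h' i i' hi.1 hi.2 hi'.1 hi'.2 (by rw [hii])
  · exact (forall_mem_family _ _ _ _).2 fun i h1 h2 => by simp [h i h1 h2]

theorem hasKeys_familyLE {k : (List ℕ × List ℕ) × Bool} {lo hi : ℕ}
    {r : ℕ → ℕ → Word n × Word n}
    (h : ∀ i j, lo ≤ i → i ≤ j → j ≤ hi → key (r i j) = k)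
    (h' : ∀ i j i' j', lo ≤ i → i ≤ j → j ≤ hi → lo ≤ i' → i' ≤ j' → j' ≤ hi →
      indices (r i j).1 = indices (r i' j').1 → i = i' ∧ j = j') :
    HasKeys [k] (familyLE lo hi r) := by
  refine ⟨Multiset.Nodup.map_on ?_ (Finset.nodup _), ?_⟩
  · rintro ⟨i, j⟩ hi ⟨i', j'⟩ hi' hii
    simp only [Finset.mem_val, Finset.mem_filter, Finset.mem_product, Finset.mem_Icc] at hi hi' hii
    exact Prod.ext_iff.2 (h' i j i' j' hi.1.1.1 hi.2 hi.1.2.2 hi'.1.1.1 hi'.2 hi'.1.2.2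
      (by rw [hii]))
  · exact (forall_mem_familyLE _ _ _ _).2 fun i j h1 h2 h3 => by simp [h i j h1 h2 h3]

theorem hasKeys_familyLT {k : (List ℕ × List ℕ) × Bool} {lo hi : ℕ}
    {r : ℕ → ℕ → Word n × Word n}
    (h : ∀ i j, lo ≤ i → i < j → j ≤ hi → key (r i j) = k)
    (h' : ∀ i j i' j', lo ≤ i → i < j → j ≤ hi → lo ≤ i' → i' < j' → j' ≤ hi →
      indices (r i j).1 = indices (r i' j').1 → i = i' ∧ j = j') :
    HasKeys [k] (familyLT lo hi r) := by
  refine ⟨Multiset.Nodup.map_on ?_ (Finset.nodup _), ?_⟩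
  · rintro ⟨i, j⟩ hi ⟨i', j'⟩ hi' hii
    simp only [Finset.mem_val, Finset.mem_filter, Finset.mem_product, Finset.mem_Icc] at hi hi' hii
    exact Prod.ext_iff.2 (h' i j i' j' hi.1.1.1 hi.2 hi.1.2.2 hi'.1.1.1 hi'.2 hi'.1.2.2
      (by rw [hii]))
  · exact (forall_mem_familyLT _ _ _ _).2 fun i j h1 h2 h3 => by simp [h i j h1 h2 h3]

end

/-- The listed relations are pairwise distinct. -/
theorem nodup_Rbar (n : ℕ) (hn : 3 ≤ n) : (Rbar n).Nodup := by
  have h1 : HasKeys [(([1, 1], [1]), false), (([1, 1], [1, 1]), false)] (R1 n) :=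
    .add (hasKeys_family ?_ ?_) (hasKeys_familyLE ?_ ?_) (by decide)
  have h1b : HasKeys [(([2, 2], [2]), false), (([2, 2], [2, 2]), false)] (R1b n) :=
    .add (hasKeys_family ?_ ?_) (hasKeys_familyLE ?_ ?_) (by decide)
  have h2 : HasKeys [(([3, 3], [3]), false), (([4, 4], [4]), false)] (R2 n) :=
    .add (hasKeys_family ?_ ?_) (hasKeys_family ?_ ?_) (by decide)
  have h3 : HasKeys [(([3, 4], [4, 3]), false), (([3, 4], [4, 3]), true), (([4, 3], [3, 4]), false),
      (([3, 3], [3, 3]), false), (([3, 3], [3]), true), (([4, 4], [4, 4]), false),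
      (([4, 4], [4]), true)] (R3 n) :=
    .add (.add (.add (.add (.add (.add (hasKeys_familyLE ?_ ?_) (hasKeys_family ?_ ?_) (by decide))
      (hasKeys_family ?_ ?_) (by decide)) (hasKeys_family ?_ ?_) (by decide))
      (hasKeys_family ?_ ?_) (by decide)) (hasKeys_family ?_ ?_) (by decide))
      (hasKeys_family ?_ ?_) (by decide)
  have h4 : HasKeys [(([1, 3], [3]), false), (([1, 3], [3, 1]), false), (([1, 3], [1]), false),
      (([3, 1], [3]), false)] (R4 n) :=
    .add (.add (.add (hasKeys_family ?_ ?_) (hasKeys_familyLE ?_ ?_) (by decide))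
      (hasKeys_singleton ?_) (by decide)) (hasKeys_family ?_ ?_) (by decide)
  have h4b : HasKeys [(([2, 4], [4]), false), (([2, 4], [4, 2]), false), (([2, 4], [2]), false),
      (([4, 2], [4]), false)] (R4b n) :=
    .add (.add (.add (hasKeys_family ?_ ?_) (hasKeys_familyLE ?_ ?_) (by decide))
      (hasKeys_singleton ?_) (by decide)) (hasKeys_family ?_ ?_) (by decide)
  -- The last two keys differ only because `n ≥ 3`: for `n = 2` the letters `a 1` and `a (n - 1)`
  -- coincide, and so do the two single relations.
  have h5 : HasKeys [(([1, 4], [4, 1]), false), (([1, 4], [4, 1]), true), (([1, 4], [3, 4]), true),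
      (([1, 4], [3, 4]), false)] (R5 n) :=
    .add (.add (.add (hasKeys_familyLE ?_ ?_) (hasKeys_familyLT ?_ ?_) (by decide))
      (hasKeys_singleton ?_) (by decide)) (hasKeys_singleton ?_) (by decide)
  have h5b : HasKeys [(([2, 3], [3, 2]), true), (([2, 3], [3, 2]), false),
      (([2, 3], [4, 3]), false), (([2, 3], [4, 3]), true)] (R5b n) :=
    .add (.add (.add (hasKeys_familyLT ?_ ?_) (hasKeys_familyLE ?_ ?_) (by decide))
      (hasKeys_singleton ?_) (by decide)) (hasKeys_singleton ?_) (by decide)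
  have h6 : HasKeys [(([4, 1], [4, 1]), false)] (R6 n) := hasKeys_family ?_ ?_
  have h6b : HasKeys [(([3, 2], [3, 2]), false)] (R6b n) := hasKeys_family ?_ ?_
  have h7 : HasKeys [(([2, 1], [1, 2]), false), (([2, 1], [1]), false), (([1, 2], [2]), false)]
      (R7 n) :=
    .add (.add (hasKeys_familyLT ?_ ?_) (hasKeys_family ?_ ?_) (by decide))
      (hasKeys_family ?_ ?_) (by decide)
  · exact ((((((((((h1.add h1b (by decide)).add h2 (by decide)).add h3 (by decide)).add h4
      (by decide)).add h4b (by decide)).add h5 (by decide)).add h5b (by decide)).add h6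
      (by decide)).add h6b (by decide)).add h7 (by decide)).1
  -- The first two alternatives compute the key of a relation; the third recovers the parameters of
  -- a family from the indices on the left-hand side.
  all_goals
    intros
    first
    | (simp (disch := omega) only [key, sq, kinds_mul, kinds_wa, kinds_wb, kinds_we, kinds_wf,
        indices_mul, indices_wa, indices_wb, indices_we, indices_wf]
       simp [sideKey]
       done)
    | (simp (disch := omega) only [key, kinds_mul, kinds_wa, kinds_wb, kinds_we, kinds_wf,
        indices_mul, indices_wa, indices_wb, indices_we, indices_wf]
       simp [sideKey]
       omega)
    | (rename_i hij
       simp (disch := omega) only [sq, indices_mul, indices_wa, indices_wb, indices_we,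
         indices_wf] at hij
       simp at hij
       omega)

theorem ncard_Rbar (n : ℕ) (hn : 3 ≤ n) :
    {r : Word n × Word n | r ∈ Rbar n}.ncard = 5 * n ^ 2 + 3 * n - 10 := by
  classical
  rw [← card_Rbar n (by omega), ← Multiset.toFinset_card_of_nodup (nodup_Rbar n hn),
    ← Set.ncard_coe_finset]
  congr 1
  ext r
  simp

end ChainPres

open ChainPres
theorem mainTheorem1 (n : ℕ) (hn : 2 ≤ n) :
    -- the letters name `4n - 4` distinct elements, which generate the monoid
    Nat.card (Letter n) = 4 * n - 4 ∧
    Function.Injective (gen n) ∧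
    Submonoid.closure (Set.range (gen n)) = ⊤ ∧
    -- the monoid is defined by the presentation, via these generators
    (∃ φ : PresentedMonoid (IsRel n) ≃* IntervalMonoid n,
      ∀ x : Letter n, φ (PresentedMonoid.of (IsRel n) x) = gen n x) ∧
    -- the number of relations; for `n = 2` some of the listed relations coincide
    Multiset.card (Rbar n) = 5 * n ^ 2 + 3 * n - 10 ∧
    (3 ≤ n → {r : Word n × Word n | r ∈ Rbar n}.ncard = 5 * n ^ 2 + 3 * n - 10) ∧
    -- canonical forms
    (∀ w : Word n, ∃ w' ∈ Wbar n, conGen (IsRel n) w w') ∧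
    (Wbar n).ncard = Nat.card (IntervalMonoid n) :=
  ⟨card_letter n hn, gen_injective n hn, closure_range_gen n hn,
    exists_presentedMonoid_equiv n hn, card_Rbar n hn, ncard_Rbar n, exists_mem_Wbar n hn,
    ncard_Wbar n hn⟩
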